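/- Let $(W,S)$ be a Coxeter system with length function $\ell$ and Bruhat order $\le$, and for $I\subseteq S$ let $W_I=\langle I\rangle$. Let ${}^IW$ (respectively $W^I$) be the set of elements $x\in W$ of minimal length in the coset $W_Ix$ (respectively $xW_I$). Let $\mathcal H$ be the Hecke algebra of $W$, that is, the associative $\mathbb Z[v^{\pm1}]$-algebra with generators $H_s$ ($s\in S$), subject to the relations $(H_s+v)(H_s-v^{-1})=0$ and the braid relations, let $H_w=H_{s_1}\cdots H_{s_m}$ for a reduced expression $w=s_1\cdots s_m$, and let $\overline{\phantom{x}}$ be the bar involution of $\mathcal H$, that is, the ring homomorphism with $\overline v=v^{-1}$ and $\overline{H_s}=H_s^{-1}$. For $I\subseteq S$ let $\mathcal H_{W_I}$ be the Hecke algebra of $W_I$ and put $\mathcal M_I=\mathrm{triv}\otimes_{\mathcal H_{W_I}}\mathcal H$ and $\mathcal N_I=\mathrm{sign}\otimes_{\mathcal H_{W_I}}\mathcal H$, where $\mathrm{triv}$ and $\mathrm{sign}$ are $\mathbb Z[v^{\pm1}]$ with $H_s$ ($s\in I$) acting by $v^{-1}$ and by $-v$, respectively; both modules carry the induced bar involution.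 For $x\in{}^IW$ put $M_x=1\otimes H_x\in\mathcal M_I$ and $N_x=1\otimes H_x\in\mathcal N_I$, and let $\underline M_x$ and $\underline N_x$ be the unique bar-invariant elements with $$\underline M_x\in M_x+\sum_{y<x}v\mathbb Z[v]\,M_y,\qquad \underline N_x\in N_x+\sum_{y<x}v\mathbb Z[v]\,N_y \qquad (y\in{}^IW).$$ For $x,y\in{}^IW$ the anti-spherical Kazhdan–Lusztig polynomials $n^I_{y,x}$ and the inverse spherical Kazhdan–Lusztig polynomials $m_I^{y,x}$ are defined by $$\underline N_x=\sum_{y\in{}^IW}n^I_{y,x}\,N_y,\qquad M_y=\sum_{x\in{}^IW}(-1)^{\ell(y)+\ell(x)}\,m_I^{y,x}\,\underline M_x .$$ **Theorem.** Let $I,J\subseteq S$ be such that $W_I$ is finite, let $w_I$ be the longest element of $W_I$, and let $${}^JW^I_{\mathrm{reg}}=\{z\in{}^JW\cap W^I \mid J\cap zIz^{-1}=\varnothing\}$$ be the set of minimal length representatives of the regular $(W_J,W_I)$-double cosets. Then $zw_I\in{}^JW$ for all $z\in{}^JW^I_{\mathrm{reg}}$, and for all $x,y\in{}^JW^I_{\mathrm{reg}}$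 we have $$\sum_{z\in{}^JW^I_{\mathrm{reg}}}(-1)^{\ell(y)+\ell(z)}\cdot n^J_{zw_I,xw_I}\cdot m_I^{z^{-1},y^{-1}}=\delta_{x,y},$$ where only finitely many terms of the sum are non-zero. -/

import Mathlib

noncomputable section

namespace ParabolicKL

/-! ## The ground ring `ℤ[v, v⁻¹]` -/

/-- The ring of Laurent polynomials `ℤ[v, v⁻¹]`. -/
abbrev LZ : Type := LaurentPolynomial ℤ

/-- The variable `v`. -/
abbrev v : LZ := LaurentPolynomial.T 1

/-- The inverse `v⁻¹` of the variable. -/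
abbrev vInv : LZ := LaurentPolynomial.T (-1)

/-- The subset `v ℤ[v]` of `ℤ[v, v⁻¹]`. -/
def vZv : Set LZ := {f | ∃ p : Polynomial ℤ, f = v * Polynomial.toLaurent p}

/-- The ring automorphism of `ℤ[v, v⁻¹]` with `v ↦ v⁻¹`. -/
def barLZ : LZ →+* LZ := (LaurentPolynomial.invert : LZ ≃ₐ[ℤ] LZ).toRingHom

theorem v_mul_vInv : v * vInv = 1 := by
  rw [← LaurentPolynomial.T_add]; simp

theorem vInv_mul_v : vInv * v = 1 := by
  rw [← LaurentPolynomial.T_add]; simp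

theorem barLZ_v : barLZ v = vInv := LaurentPolynomial.invert_T 1

theorem barLZ_vInv : barLZ vInv = v := by
  have h := LaurentPolynomial.invert_T (R := ℤ) (-1)
  rwa [neg_neg] at h

/-! ## Alternating products -/

/-- The alternating product `a b a ⋯` with `n` factors. -/
def altProd {A : Type*} [Monoid A] (a b : A) : ℕ → A
  | 0 => 1
  | n + 1 => a * altProd b a n

theorem altProd_self {A : Type*} [Monoid A] (a : A) (n : ℕ) : altProd a a n = a ^ n := by
  induction n with
  | zero => simp [altProd]
  | succ n ih => rw [altProd, ih, pow_succ']

theorem map_altProd {A A' : Type*} [Monoid A] [Monoid A'] (φ : A →* A') (n : ℕ) :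
    ∀ a b : A, φ (altProd a b n) = altProd (φ a) (φ b) n := by
  induction n with
  | zero => intro a b; simp [altProd]
  | succ n ih => intro a b; rw [altProd, altProd, map_mul, ih]

theorem altProd_succ_right {A : Type*} [Monoid A] (n : ℕ) :
    ∀ a b : A, altProd a b (n + 1) = altProd a b n * (if Even n then a else b) := by
  induction n with
  | zero => intro a b; simp [altProd]
  | succ n ih =>
    intro a b
    rw [altProd, ih b a, altProd, ← mul_assoc]
    by_cases h : Even n <;> simp [h, Nat.even_add_one]

theorem inv_altProd {G : Type*} [Group G] (n : ℕ) :
    ∀ a b : G, (altProd a b n)⁻¹ =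
      if Even n then altProd b⁻¹ a⁻¹ n else altProd a⁻¹ b⁻¹ n := by
  induction n with
  | zero => intro a b; simp [altProd]
  | succ n ih =>
    intro a b
    rw [altProd_succ_right, mul_inv_rev, ih]
    by_cases h : Even n <;> simp [h, Nat.even_add_one, altProd]

theorem altProd_inv_comm {G : Type*} [Group G] {a b : G} {n : ℕ}
    (h : altProd a b n = altProd b a n) : altProd a⁻¹ b⁻¹ n = altProd b⁻¹ a⁻¹ n := by
  have h' := congrArg (fun g => g⁻¹) h
  simp only [inv_altProd] at h'
  by_cases hn : Even n
  · simp only [hn, if_true] at h'; exact h'.symm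
  · simpa only [hn, if_false] using h'

/-! ## The Hecke algebra -/

section Hecke

variable {B : Type*}

/-- The quadratic relations and the braid relations. An entry `M s t = 0` of a Coxeter matrix stands
for `m_{st} = ∞`; the corresponding braid relation reads `1 = 1`, that is, it is void. -/
inductive HeckeRel (M : CoxeterMatrix B) : FreeAlgebra LZ B → FreeAlgebra LZ B → Prop
  | quadratic (s : B) : HeckeRel M
      ((FreeAlgebra.ι LZ s + algebraMap LZ _ v) * (FreeAlgebra.ι LZ s - algebraMap LZ _ vInv)) 0
  | braid (s t : B) : HeckeRel M
      (altProd (FreeAlgebra.ι LZ s) (FreeAlgebra.ι LZ t) (M s t))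
      (altProd (FreeAlgebra.ι LZ t) (FreeAlgebra.ι LZ s) (M s t))

/-- The Hecke algebra: the associative `ℤ[v, v⁻¹]`-algebra with generators `H_s`, subject to the
quadratic relations and the braid relations. -/
def HeckeAlgebra (M : CoxeterMatrix B) : Type _ := RingQuot (HeckeRel M)

instance (M : CoxeterMatrix B) : Ring (HeckeAlgebra M) := RingQuot.instRing (HeckeRel M)

instance (M : CoxeterMatrix B) : Algebra LZ (HeckeAlgebra M) := RingQuot.instAlgebra (HeckeRel M)

/-- The quotient map from the free algebra. -/
def mk (M : CoxeterMatrix B) : FreeAlgebra LZ B →ₐ[LZ] HeckeAlgebra M :=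
  RingQuot.mkAlgHom LZ (HeckeRel M)

theorem mk_rel (M : CoxeterMatrix B) {x y : FreeAlgebra LZ B} (h : HeckeRel M x y) :
    mk M x = mk M y := RingQuot.mkAlgHom_rel LZ h

theorem mk_surjective (M : CoxeterMatrix B) : Function.Surjective (mk M) :=
  RingQuot.mkAlgHom_surjective LZ (HeckeRel M)

/-- The generator `H_s` of the Hecke algebra. -/
def gen (M : CoxeterMatrix B) (s : B) : HeckeAlgebra M := mk M (FreeAlgebra.ι LZ s)

theorem gen_quadratic (M : CoxeterMatrix B) (s : B) :
    (gen M s + algebraMap LZ (HeckeAlgebra M) v) * (gen M s - algebraMap LZ (HeckeAlgebra M) vInv)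
      = 0 := by
  have h := mk_rel M (HeckeRel.quadratic s)
  rw [map_mul, map_add, map_sub, AlgHom.commutes, AlgHom.commutes, map_zero] at h
  exact h

theorem gen_braid (M : CoxeterMatrix B) (s t : B) :
    altProd (gen M s) (gen M t) (M s t) = altProd (gen M t) (gen M s) (M s t) := by
  have h := mk_rel M (HeckeRel.braid s t)
  have e := fun a b => map_altProd (mk M : FreeAlgebra LZ B →* HeckeAlgebra M) (M s t) a b
  exact (e _ _).symm.trans (h.trans (e _ _))

/-- The ring homomorphism out of a free algebra that is given by `σ` on scalars, with central
image, and by `f` on generators. -/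
def freeLift {A : Type*} [Ring A] (σ : LZ →+* A) (hσ : ∀ r a, σ r * a = a * σ r) (f : B → A) :
    FreeAlgebra LZ B →+* A :=
  letI : Algebra LZ A := σ.toAlgebra' hσ
  (FreeAlgebra.lift LZ f : FreeAlgebra LZ B →ₐ[LZ] A).toRingHom

theorem freeLift_algebraMap {A : Type*} [Ring A] (σ : LZ →+* A) (hσ : ∀ r a, σ r * a = a * σ r)
    (f : B → A) (r : LZ) : freeLift σ hσ f (algebraMap LZ _ r) = σ r := by
  let _ : Algebra LZ A := σ.toAlgebra' hσ
  exact (FreeAlgebra.lift LZ f : FreeAlgebra LZ B →ₐ[LZ] A).commutes r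

theorem freeLift_ι {A : Type*} [Ring A] (σ : LZ →+* A) (hσ : ∀ r a, σ r * a = a * σ r)
    (f : B → A) (s : B) : freeLift σ hσ f (FreeAlgebra.ι LZ s) = f s := by
  let _ : Algebra LZ A := σ.toAlgebra' hσ
  exact FreeAlgebra.lift_ι_apply (R := LZ) f s

/-- The ring homomorphism out of the Hecke algebra that is given by `σ` on scalars, with central
image, and by `f` on generators, where the elements `f s` satisfy the defining relations. -/
def heckeLift (M : CoxeterMatrix B) {A : Type*} [Ring A] (σ : LZ →+* A)
    (hσ : ∀ r a, σ r * a = a * σ r) (f : B → A)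
    (hquad : ∀ s, (f s + σ v) * (f s - σ vInv) = 0)
    (hbraid : ∀ s t, altProd (f s) (f t) (M s t) = altProd (f t) (f s) (M s t)) :
    HeckeAlgebra M →+* A :=
  RingQuot.lift ⟨freeLift σ hσ f, by
    intro x y h
    cases h with
    | quadratic s =>
      rw [map_mul, map_add, map_sub, freeLift_algebraMap, freeLift_algebraMap, freeLift_ι, hquad,
        map_zero]
    | braid s t =>
      have e := fun a b => map_altProd (freeLift σ hσ f : FreeAlgebra LZ B →* A) (M s t) a b
      refine (e _ _).trans (Eq.trans ?_ (e _ _).symm)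
      simpa only [MonoidHom.coe_coe, freeLift_ι] using hbraid s t⟩

section

variable (M : CoxeterMatrix B) {A : Type*} [Ring A] (σ : LZ →+* A)
  (hσ : ∀ r a, σ r * a = a * σ r) (f : B → A)
  (hquad : ∀ s, (f s + σ v) * (f s - σ vInv) = 0)
  (hbraid : ∀ s t, altProd (f s) (f t) (M s t) = altProd (f t) (f s) (M s t))

theorem heckeLift_mk (x : FreeAlgebra LZ B) :
    heckeLift M σ hσ f hquad hbraid (mk M x) = freeLift σ hσ f x := by
  have h : mk M x = RingQuot.mkRingHom (HeckeRel M) x := by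
    rw [mk, ← RingQuot.mkAlgHom_coe LZ (HeckeRel M)]; rfl
  rw [h]
  exact RingQuot.lift_mkRingHom_apply _ _ _

theorem heckeLift_gen (s : B) : heckeLift M σ hσ f hquad hbraid (gen M s) = f s := by
  rw [gen, heckeLift_mk, freeLift_ι]

theorem heckeLift_algebraMap (r : LZ) :
    heckeLift M σ hσ f hquad hbraid (algebraMap LZ _ r) = σ r := by
  rw [← AlgHom.commutes (mk M) r, heckeLift_mk, freeLift_algebraMap]

end

/-- Two ring homomorphisms out of the Hecke algebra agree if they agree on scalars and on the
generators `H_s`. -/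
theorem hecke_ringHom_ext (M : CoxeterMatrix B) {A : Type*} [Semiring A]
    {f g : HeckeAlgebra M →+* A}
    (h₁ : ∀ r : LZ, f (algebraMap LZ _ r) = g (algebraMap LZ _ r))
    (h₂ : ∀ s, f (gen M s) = g (gen M s)) : f = g := by
  ext x
  obtain ⟨a, rfl⟩ := mk_surjective M x
  induction a using FreeAlgebra.induction with
  | grade0 r => rw [AlgHom.commutes]; exact h₁ r
  | grade1 s => exact h₂ s
  | mul a b ha hb => rw [map_mul, map_mul, map_mul, ha, hb]
  | add a b ha hb => rw [map_add, map_add, map_add, ha, hb]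

/-- The generator `H_s` as a unit, with inverse `H_s + v - v⁻¹`. -/
def genUnit (M : CoxeterMatrix B) (s : B) : (HeckeAlgebra M)ˣ where
  val := gen M s
  inv := gen M s + algebraMap LZ _ (v - vInv)
  val_inv := by
    have h := gen_quadratic M s
    have hc := Algebra.commutes v (gen M s)
    have h1 : algebraMap LZ (HeckeAlgebra M) v * algebraMap LZ (HeckeAlgebra M) vInv = 1 := by
      rw [← map_mul, v_mul_vInv, map_one]
    rw [add_mul, mul_sub, mul_sub, h1, hc] at h
    rw [map_sub, mul_add, mul_sub, ← sub_eq_zero]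
    rw [← h]; abel
  inv_val := by
    have h := gen_quadratic M s
    have hc := Algebra.commutes vInv (gen M s)
    have h1 : algebraMap LZ (HeckeAlgebra M) v * algebraMap LZ (HeckeAlgebra M) vInv = 1 := by
      rw [← map_mul, v_mul_vInv, map_one]
    rw [add_mul, mul_sub, mul_sub, h1, ← hc] at h
    rw [map_sub, add_mul, sub_mul, ← sub_eq_zero]
    rw [← h]; abel

/-- The bar involution of the Hecke algebra: the ring homomorphism with `v ↦ v⁻¹` and
`H_s ↦ H_s⁻¹`. -/
def bar (M : CoxeterMatrix B) : HeckeAlgebra M →+* HeckeAlgebra M :=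
  heckeLift M ((algebraMap LZ (HeckeAlgebra M)).comp barLZ)
    (fun r a => Algebra.commutes (barLZ r) a)
    (fun s => (((genUnit M s)⁻¹ : (HeckeAlgebra M)ˣ) : HeckeAlgebra M))
    (by
      intro s
      have h := (genUnit M s).inv_val
      change (gen M s + algebraMap LZ _ (v - vInv)) * gen M s = 1 at h
      change (gen M s + algebraMap LZ _ (v - vInv) + algebraMap LZ _ (barLZ v)) *
        (gen M s + algebraMap LZ _ (v - vInv) - algebraMap LZ _ (barLZ vInv)) = 0
      rw [barLZ_v, barLZ_vInv, map_sub]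
      have h' := gen_quadratic M s
      rw [← h']
      congr 1 <;> abel)
    (by
      intro s t
      have e := fun a b => map_altProd (Units.coeHom (HeckeAlgebra M)) (M s t) a b
      have h : altProd (genUnit M s) (genUnit M t) (M s t)
          = altProd (genUnit M t) (genUnit M s) (M s t) :=
        Units.ext ((e _ _).trans ((gen_braid M s t).trans (e (genUnit M t) (genUnit M s)).symm))
      have h' := congrArg (Units.coeHom (HeckeAlgebra M)) (altProd_inv_comm h)
      rwa [e, e] at h')

theorem bar_gen (M : CoxeterMatrix B) (s : B) :
    bar M (gen M s) = gen M s + algebraMap LZ _ (v - vInv) := heckeLift_gen ..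

theorem bar_algebraMap (M : CoxeterMatrix B) (r : LZ) :
    bar M (algebraMap LZ _ r) = algebraMap LZ _ (barLZ r) := heckeLift_algebraMap ..

/-- The bar involution as a semilinear map. -/
def barₛₗ (M : CoxeterMatrix B) : HeckeAlgebra M →ₛₗ[barLZ] HeckeAlgebra M where
  toFun := bar M
  map_add' := map_add _
  map_smul' r x := by rw [Algebra.smul_def, map_mul, bar_algebraMap, Algebra.smul_def]

/-! ## The one-dimensional modules -/

/-- Labels for the two one-dimensional modules `triv` and `sign` of a Hecke algebra. -/
inductive OneDim
  | triv
  | sign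

/-- The scalar by which each `H_s` acts: `v⁻¹` on `triv` and `-v` on `sign`. -/
def OneDim.scalar : OneDim → LZ
  | .triv => vInv
  | .sign => -v

theorem OneDim.scalar_quadratic (ε : OneDim) : (ε.scalar + v) * (ε.scalar - vInv) = 0 := by
  cases ε <;> simp [OneDim.scalar]

theorem OneDim.bar_scalar (ε : OneDim) : barLZ ε.scalar = ε.scalar + (v - vInv) := by
  cases ε
  · simp only [OneDim.scalar, barLZ_vInv]; ring
  · simp only [OneDim.scalar, map_neg, barLZ_v]; ring

/-- The action of the Hecke algebra on the one-dimensional module `ε`. -/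
def OneDim.char (ε : OneDim) (M : CoxeterMatrix B) : HeckeAlgebra M →+* LZ :=
  heckeLift M (RingHom.id LZ) (fun r a => mul_comm r a) (fun _ => ε.scalar)
    (fun _ => ε.scalar_quadratic) (fun _ _ => rfl)

theorem OneDim.barLZ_char (ε : OneDim) (M : CoxeterMatrix B) (h : HeckeAlgebra M) :
    barLZ (ε.char M h) = ε.char M (bar M h) := by
  have key : barLZ.comp (ε.char M) = (ε.char M).comp (bar M) := by
    have e := fun r => heckeLift_algebraMap M (RingHom.id LZ) (fun r a => mul_comm r a)
      (fun _ => ε.scalar) (fun _ => ε.scalar_quadratic) (fun _ _ => rfl) r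
    have g := fun s => heckeLift_gen M (RingHom.id LZ) (fun r a => mul_comm r a)
      (fun _ => ε.scalar) (fun _ => ε.scalar_quadratic) (fun _ _ => rfl) s
    refine hecke_ringHom_ext M (fun r => ?_) (fun s => ?_)
    · rw [RingHom.comp_apply, RingHom.comp_apply, bar_algebraMap, OneDim.char, e, e]; rfl
    · rw [RingHom.comp_apply, RingHom.comp_apply, bar_gen, map_add, OneDim.char, e, g,
        OneDim.bar_scalar]; rfl
  exact RingHom.congr_fun key h

/-! ## Parabolic subalgebras and the (anti-)spherical modules -/

/-- The Coxeter matrix of the parabolic subgroup `W_I`. -/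
def restrict (M : CoxeterMatrix B) (I : Set B) : CoxeterMatrix I where
  M := Matrix.of fun s t => M s t
  isSymm := by
    ext s t
    exact M.symmetric t s
  diagonal s := M.diagonal s
  off_diagonal s t h := M.off_diagonal s t fun h' => h (Subtype.ext h')

/-- The homomorphism from the Hecke algebra of `W_I` to the Hecke algebra of `W` with `H_s ↦ H_s`
for `s ∈ I`; through it the Hecke algebra of `W` is a left module over that of `W_I`. -/
def incl (M : CoxeterMatrix B) (I : Set B) : HeckeAlgebra (restrict M I) →+* HeckeAlgebra M :=
  heckeLift (restrict M I) (algebraMap LZ (HeckeAlgebra M)) (fun r a => Algebra.commutes r a)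
    (fun s => gen M s) (fun s => gen_quadratic M s) (fun s t => gen_braid M s t)

theorem bar_incl (M : CoxeterMatrix B) (I : Set B) (h : HeckeAlgebra (restrict M I)) :
    bar M (incl M I h) = incl M I (bar (restrict M I) h) := by
  have key : (bar M).comp (incl M I) = (incl M I).comp (bar (restrict M I)) := by
    have e := fun r => heckeLift_algebraMap (restrict M I) (algebraMap LZ (HeckeAlgebra M))
      (fun r a => Algebra.commutes r a)
      (fun s => gen M s) (fun s => gen_quadratic M s) (fun s t => gen_braid M s t) r
    have g := fun s => heckeLift_gen (restrict M I) (algebraMap LZ (HeckeAlgebra M))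
      (fun r a => Algebra.commutes r a)
      (fun s => gen M s) (fun s => gen_quadratic M s) (fun s t => gen_braid M s t) s
    refine hecke_ringHom_ext _ (fun r => ?_) (fun s => ?_)
    · rw [RingHom.comp_apply, RingHom.comp_apply, bar_algebraMap, incl, e, e, bar_algebraMap]
    · rw [RingHom.comp_apply, RingHom.comp_apply, bar_gen, map_add, incl, e, g, bar_gen]
  exact RingHom.congr_fun key h

open scoped TensorProduct

/-- The relations `(a · h) ⊗ x = a ⊗ (h x)`, for `h` in the Hecke algebra of `W_I`, that define the
tensor product over the Hecke algebra of `W_I` as a quotient of the tensor product over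
`ℤ[v, v⁻¹]`. -/
def balanced (M : CoxeterMatrix B) (I : Set B) (ε : OneDim) :
    Submodule LZ (LZ ⊗[LZ] HeckeAlgebra M) :=
  Submodule.span LZ {u | ∃ (a : LZ) (h : HeckeAlgebra (restrict M I)) (x : HeckeAlgebra M),
    u = (a * ε.char (restrict M I) h) ⊗ₜ[LZ] x - a ⊗ₜ[LZ] (incl M I h * x)}

/-- The module `ε ⊗ H` induced from the one-dimensional module `ε` of the Hecke algebra of `W_I`:
for `ε = triv` this is the spherical module `𝓜_I`, for `ε = sign` the anti-spherical module
`𝓝_I`. -/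
abbrev IndModule (M : CoxeterMatrix B) (I : Set B) (ε : OneDim) : Type _ :=
  (LZ ⊗[LZ] HeckeAlgebra M) ⧸ balanced M I ε

/-- The element `1 ⊗ x` of the induced module. -/
def oneTmul (M : CoxeterMatrix B) (I : Set B) (ε : OneDim) (x : HeckeAlgebra M) :
    IndModule M I ε :=
  (balanced M I ε).mkQ (1 ⊗ₜ[LZ] x)

/-- The involution `a ⊗ x ↦ ā ⊗ x̄` of `ℤ[v, v⁻¹] ⊗ H`. -/
def barTensor (M : CoxeterMatrix B) :
    LZ ⊗[LZ] HeckeAlgebra M →ₛₗ[barLZ] LZ ⊗[LZ] HeckeAlgebra M :=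
  TensorProduct.map (barLZ.toSemilinearMap) (barₛₗ M)

theorem balanced_le_comap (M : CoxeterMatrix B) (I : Set B) (ε : OneDim) :
    balanced M I ε ≤ (balanced M I ε).comap (barTensor M) := by
  refine Submodule.span_le.2 ?_
  rintro _ ⟨a, h, x, rfl⟩
  refine Submodule.subset_span ⟨barLZ a, bar _ h, bar M x, ?_⟩
  have h1 : barTensor M ((a * ε.char (restrict M I) h) ⊗ₜ[LZ] x)
      = barLZ (a * ε.char (restrict M I) h) ⊗ₜ[LZ] bar M x := rfl
  have h2 : barTensor M (a ⊗ₜ[LZ] (incl M I h * x))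
      = barLZ a ⊗ₜ[LZ] bar M (incl M I h * x) := rfl
  rw [map_sub, h1, h2, map_mul, map_mul, OneDim.barLZ_char, bar_incl]

/-- The bar involution of the induced module: `a ⊗ x ↦ ā ⊗ x̄`. -/
def barInd (M : CoxeterMatrix B) (I : Set B) (ε : OneDim) :
    IndModule M I ε →ₛₗ[barLZ] IndModule M I ε :=
  Submodule.mapQ _ _ (barTensor M) (balanced_le_comap M I ε)

end Hecke

/-! ## Coxeter groups -/

section Coxeter

variable {B : Type*} {M : CoxeterMatrix B} {W : Type*} [Group W] (cs : CoxeterSystem M W)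

/-- The strict Bruhat order: the transitive relation generated by `u < u t` for reflections `t`
with `ℓ(u) < ℓ(u t)`. -/
def BruhatLT : W → W → Prop :=
  Relation.TransGen fun u w => ∃ t, cs.IsReflection t ∧ w = u * t ∧ cs.length u < cs.length w

/-- The parabolic subgroup `W_I`. -/
def parabolic (I : Set B) : Subgroup W := Subgroup.closure (cs.simple '' I)

/-- The set `ᴵW` of elements `x` that have minimal length in the coset `W_I x`. -/
def minLeft (I : Set B) : Set W := {x | ∀ w ∈ parabolic cs I, cs.length x ≤ cs.length (w * x)}

/-- The set `Wᴵ` of elements `x` that have minimal length in the coset `x W_I`. -/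
def minRight (I : Set B) : Set W := {x | ∀ w ∈ parabolic cs I, cs.length x ≤ cs.length (x * w)}

theorem inv_mem_minLeft {I : Set B} {x : W} (hx : x ∈ minRight cs I) : x⁻¹ ∈ minLeft cs I := by
  intro w hw
  have h := hx w⁻¹ (inv_mem hw)
  rwa [← cs.length_inv x, ← cs.length_inv (x * w⁻¹), mul_inv_rev, inv_inv] at h

/-- The set of minimal length representatives of the regular `(W_J, W_I)`-double cosets: the
elements `z` of `ᴶW ∩ Wᴵ` with `J ∩ z I z⁻¹ = ∅`. -/
def regReps (J I : Set B) : Set W :=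
  {z | z ∈ minLeft cs J ∧ z ∈ minRight cs I ∧
    Disjoint (cs.simple '' J) ((fun g => z * g * z⁻¹) '' (cs.simple '' I))}

theorem exists_longest (I : Set B) (hI : Finite (parabolic cs I)) :
    ∃ w : W, w ∈ parabolic cs I ∧ ∀ u ∈ parabolic cs I, cs.length u ≤ cs.length w := by
  obtain ⟨w, hw⟩ := Finite.exists_max fun u : parabolic cs I => cs.length (u : W)
  exact ⟨w, w.2, fun u hu => hw ⟨u, hu⟩⟩

/-- The longest element `w_I` of a finite parabolic subgroup `W_I`. -/
def longest (I : Set B) (hI : Finite (parabolic cs I)) : W := (exists_longest cs I hI).choose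

/-! ## Standard bases, Kazhdan–Lusztig bases and Kazhdan–Lusztig polynomials -/

/-- The element `H_w` of the Hecke algebra: the product `H_{s₁} ⋯ H_{sₘ}` for a reduced expression
`w = s₁ ⋯ sₘ`. -/
def stdHecke (w : W) : HeckeAlgebra M := ((cs.exists_isReduced w).choose.map (gen M)).prod

/-- The standard elements `1 ⊗ H_x` for `x ∈ ᴵW`: this is `M_x` for `ε = triv` and `N_x` for
`ε = sign`. -/
def stdInd (I : Set B) (ε : OneDim) (x : minLeft cs I) : IndModule M I ε :=
  oneTmul M I ε (stdHecke cs (x : W))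

/-- `C` is self-dual and is the sum of `1 ⊗ H_x` and a linear combination of the `1 ⊗ H_y`
with `y < x` and coefficients in `v ℤ[v]`. -/
def IsKL (I : Set B) (ε : OneDim) (x : minLeft cs I) (C : IndModule M I ε) : Prop :=
  barInd M I ε C = C ∧
  ∃ f : minLeft cs I →₀ LZ, (∀ y, f y ∈ vZv) ∧ (∀ y, f y ≠ 0 → BruhatLT cs (y : W) (x : W)) ∧
    C = stdInd cs I ε x + Finsupp.linearCombination LZ (stdInd cs I ε) f

/-- The Kazhdan–Lusztig basis element attached to `x ∈ ᴵW`: the element characterized by `IsKL`. -/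
def klInd (I : Set B) (ε : OneDim) (x : minLeft cs I) : IndModule M I ε :=
  Classical.epsilon (IsKL cs I ε x)

/-- The coordinates of `m` with respect to a basis `b`. -/
def coords {ι N : Type*} [AddCommGroup N] [Module LZ N] (b : ι → N) (m : N) : ι →₀ LZ :=
  Function.invFun (Finsupp.linearCombination LZ b) m

/-- The parabolic Kazhdan–Lusztig polynomial with indices `y, x`: the coefficient of the standard
basis element of `y` in the Kazhdan–Lusztig basis element of `x`. -/
def klPoly (I : Set B) (ε : OneDim) (y x : minLeft cs I) : LZ :=
  coords (stdInd cs I ε) (klInd cs I ε x) y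

/-- The inverse parabolic Kazhdan–Lusztig polynomial with indices `y, x`: up to the sign
`(-1)^(ℓ(y) + ℓ(x))`, the coefficient of the Kazhdan–Lusztig basis element of `x` in the standard
basis element of `y`. -/
def invKLPoly (I : Set B) (ε : OneDim) (y x : minLeft cs I) : LZ :=
  (-1) ^ (cs.length (y : W) + cs.length (x : W)) * coords (klInd cs I ε) (stdInd cs I ε y) x

/-- The anti-spherical Kazhdan–Lusztig polynomial `n^J_{y,x}`, for `x, y ∈ ᴶW`. -/
def antisphericalKL (J : Set B) (y x : minLeft cs J) : LZ := klPoly cs J .sign y x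

/-- The inverse spherical Kazhdan–Lusztig polynomial `m_I^{y,x}`, for `x, y ∈ ᴵW`. -/
def inverseSphericalKL (I : Set B) (y x : minLeft cs I) : LZ := invKLPoly cs I .triv y x

end Coxeter

end ParabolicKL

end

/-!
The theorem compares two systems of coordinates under a linear map `Φ = compMap` from the spherical
module of `I` to the anti-spherical module of `J`. Let `C = symElt` be the sum of the
`v ^ (ℓ(w_I) - ℓ(w)) H_w` with `w` in `W_I`. It satisfies `H_s C = v⁻¹ C` for `s ∈ I`
(`gen_mul_symElt`), so the formula `1 ⊗ h ↦ 1 ⊗ h' C`, where `h ↦ h'` is the anti-involution with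
`H_s ↦ H_s`, defines `Φ`. Since `C` is bar-invariant (`bar_symElt`), `Φ` commutes with the bar
involutions (`compMap_barInd`).

For a regular double coset representative `z`, all products `z w` with `w ∈ W_I` lie in `ᴶW`
(`mul_mem_minLeft_of_regReps`), hence `Φ` maps the standard element of `z⁻¹` to the sum of the
`v ^ (ℓ(w_I) - ℓ(w)) N_{z w}`; this is `N_{z w_I}` up to coefficients in `v ℤ[v]`. For all other
`x ∈ ᴵW`, a simple reflection in `J` shows that the image of the standard element of `x` is zero or
`-v` times the image of another one (`compMap_stdInd_of_not_regReps`). As these images have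
coefficients in `ℤ[v]`, those of the image of `x` are then in `v ℤ[v]`. A bar-invariant element
with all coefficients in `v ℤ[v]` vanishes (`eq_zero_of_barInd_eq`). Therefore `Φ` maps the
Kazhdan–Lusztig basis element of `z⁻¹` to that of `z w_I` (`compMap_klInd_regInv`) and kills the
other ones (`compMap_klInd_of_not_regReps`).

Now the Kazhdan–Lusztig element of `x w_I` is in the image of `Φ`, which is spanned by the images
`E_z` of the standard elements of the `z⁻¹`. As `E_z` has coefficient `1` at `z w_I` and `0` at the
other `z' w_I`, the coefficients of this combination are the polynomials `n_{z w_I, x w_I}`. The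
coordinates of `E_z` in the Kazhdan–Lusztig basis are those of the standard element of `z⁻¹`, that
is, inverse spherical polynomials up to sign. Comparing coordinates at `y w_I` yields the formula
(`exists_finsupp_inversion`); in particular the sum has finitely many non-zero terms.

The bases that this argument relies on are constructed from the strong exchange property
(`strong_exchange`), which is proved with the action of `W` on pairs of an element and a sign.
That `H_w` is independent of the reduced expression is `matsumoto`; its proof needs that the order
of `s_i s_j` is not a proper divisor of `m_{ij}`, which the geometric representation shows. Linear
independence of the `H_w` comes from the regular representation `regRep` on the free module with
basis `W`, where the braid relations follow from the fact that left operators commute with right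
ones. The bar involution is unitriangular for the Bruhat order (`bar_stdHecke_sub_mem`), and the
existence of the Kazhdan–Lusztig basis (`exists_isKL`) follows by induction on the length.
-/

noncomputable section

namespace ParabolicKL

/-! ### The geometric representation and the orders of the products of simple reflections -/

section Geometric

variable {B : Type*} (M : CoxeterMatrix B)

/-- The simple coroot of `i`, as a linear form on the space with basis the simple roots: it takes
the value `-2 cos (π / m_{ij})` on the simple root of `j`. For `m_{ij} = ∞`, encoded as `0`, the
convention `π / 0 = 0` yields the correct value `-2`. -/
def coroot (i : B) : Module.Dual ℝ (B →₀ ℝ) :=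
  Finsupp.linearCombination ℝ fun j => -2 * Real.cos (Real.pi / M i j)

theorem coroot_single (i j : B) :
    coroot M i (Finsupp.single j 1) = -2 * Real.cos (Real.pi / M i j) := by
  simp [coroot]

theorem coroot_self (i : B) : coroot M i (Finsupp.single i 1) = 2 := by
  rw [coroot_single, M.diagonal]; simp

/-- The reflection in the simple root of `i`. -/
def geomRefl (i : B) : (B →₀ ℝ) ≃ₗ[ℝ] (B →₀ ℝ) := Module.reflection (coroot_self M i)

theorem sin_two_pi_div_pos {m : ℕ} (hm : 3 ≤ m) : 0 < Real.sin (2 * (Real.pi / m)) := by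
  have hm' : (3 : ℝ) ≤ m := by exact_mod_cast hm
  have hp := Real.pi_pos
  apply Real.sin_pos_of_pos_of_lt_pi
  · positivity
  · rw [← mul_div_assoc, div_lt_iff₀ (by linarith)]
    nlinarith

theorem coroot_mul_coroot (i j : B) :
    2 * Real.cos (2 * (Real.pi / M i j)) = coroot M i (Finsupp.single j 1) *
      coroot M j (Finsupp.single i 1) - 2 := by
  rw [coroot_single, coroot_single, M.symmetric j i, Real.cos_two_mul]; ring

open Polynomial.Chebyshev in
/-- The relation `(s_i s_j) ^ m_{ij} = 1` in the geometric representation. Powers of a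
product of two reflections are given by a formula whose coefficients are values of Chebyshev
polynomials of the second kind, here at `2 cos (2 π / m_{ij})`; these are quotients of sines. -/
theorem geomRefl_mul_pow (i j : B) : (geomRefl M i * geomRefl M j) ^ M i j = 1 := by
  by_cases hij : i = j
  · subst hij
    rw [M.diagonal, pow_one]
    ext1 z
    exact Module.involutive_reflection (coroot_self M i) z
  · obtain ⟨m, hm⟩ : ∃ m, m = M i j := ⟨_, rfl⟩
    have ht := coroot_mul_coroot M i j
    have hfy := coroot_single M i j
    have hgx := coroot_single M j i
    rw [M.symmetric j i] at hgx
    have h1 : M i j ≠ 1 := M.off_diagonal i j hij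
    rw [← hm] at *
    rcases Nat.lt_or_ge m 3 with h3 | h3
    · obtain rfl | rfl : m = 0 ∨ m = 2 := by omega
      · rw [pow_zero]
      · have e0 : coroot M i (Finsupp.single j 1) = 0 := by rw [hfy]; simp
        have e1 : coroot M j (Finsupp.single i 1) = 0 := by rw [hgx]; simp
        ext1 z
        simp only [pow_two, LinearEquiv.mul_apply, geomRefl, Module.reflection_apply, map_sub,
          map_smul, e0, e1, coroot_self, LinearEquiv.coe_one, id]
        module
    · ext1 z
      have hs := sin_two_pi_div_pos h3
      have hm0 : (m : ℝ) ≠ 0 := by positivity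
      have key : ∀ n : ℤ, (S ℝ n).eval (2 * Real.cos (2 * (Real.pi / m))) *
          Real.sin (2 * (Real.pi / m)) = Real.sin ((n + 1) * (2 * (Real.pi / m))) :=
        fun n => S_two_mul_real_cos _ n
      rw [geomRefl, geomRefl,
        Module.reflection_mul_reflection_pow_apply (coroot_self M i) (coroot_self M j) m z _ ht]
      rcases Nat.even_or_odd' m with ⟨k, rfl | rfl⟩
      · have z1 : (S ℝ (((2 * k : ℕ) - 2 : ℤ) / 2)).eval
            (2 * Real.cos (2 * (Real.pi / (2 * k : ℕ)))) = 0 := by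
          have := key (((2 * k : ℕ) - 2 : ℤ) / 2)
          rw [show (((2 * k : ℕ) - 2 : ℤ) / 2) = (k : ℤ) - 1 by omega] at *
          rw [show ((((k : ℤ) - 1 : ℤ) : ℝ) + 1) * (2 * (Real.pi / (2 * k : ℕ))) = Real.pi by
            push_cast at hm0 ⊢
            field_simp
            ring_nf
            field_simp [right_ne_zero_of_mul hm0], Real.sin_pi] at this
          exact (mul_eq_zero.1 this).resolve_right hs.ne'
        have z2 := z1
        rw [show (((2 * k : ℕ) - 2 : ℤ) / 2) = (((2 * k : ℕ) - 1 : ℤ) / 2) by omega] at z2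
        rw [z1, z2]; simp
      · have z1 : (S ℝ (k : ℤ)).eval (2 * Real.cos (2 * (Real.pi / (2 * k + 1 : ℕ)))) +
            (S ℝ ((k : ℤ) - 1)).eval (2 * Real.cos (2 * (Real.pi / (2 * k + 1 : ℕ)))) = 0 := by
          have a := key k
          have b := key ((k : ℤ) - 1)
          have c : Real.sin (((k : ℤ) + 1) * (2 * (Real.pi / (2 * k + 1 : ℕ)))) =
              - Real.sin ((((k : ℤ) - 1 : ℤ) + 1) * (2 * (Real.pi / (2 * k + 1 : ℕ)))) := by
            rw [← Real.sin_neg, ← Real.sin_add_two_pi (-_)]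
            congr 1
            push_cast at hm0 ⊢; field_simp; ring
          rw [c, ← b] at a
          have : ((S ℝ (k : ℤ)).eval (2 * Real.cos (2 * (Real.pi / (2 * k + 1 : ℕ)))) +
            (S ℝ ((k : ℤ) - 1)).eval (2 * Real.cos (2 * (Real.pi / (2 * k + 1 : ℕ))))) *
              Real.sin (2 * (Real.pi / (2 * k + 1 : ℕ))) = 0 := by linarith
          exact (mul_eq_zero.1 this).resolve_right hs.ne'
        rw [show (((2 * k + 1 : ℕ) : ℤ) - 1) / 2 = k by omega,
          show (((2 * k + 1 : ℕ) : ℤ) - 3) / 2 = (k : ℤ) - 1 by omega,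
          show (((2 * k + 1 : ℕ) : ℤ) - 2) / 2 = (k : ℤ) - 1 by omega,
          show (((2 * k + 1 : ℕ) : ℤ)) / 2 = (k : ℤ) by omega, z1]
        simp

open Polynomial.Chebyshev in
/-- The order of `s_i s_j` in the geometric representation is a multiple of `m_{ij}` (it is infinite
if `m_{ij} = 0`), as the image of the simple root of `i` shows. -/
theorem dvd_of_geomRefl_mul_pow_eq_one (i j : B) (k : ℕ)
    (h : (geomRefl M i * geomRefl M j) ^ k = 1) : M i j ∣ k := by
  by_cases hij : i = j
  · subst hij
    rw [M.diagonal]; exact one_dvd _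
  · obtain ⟨m, hm⟩ : ∃ m, m = M i j := ⟨_, rfl⟩
    have ht := coroot_mul_coroot M i j
    have hgx := coroot_single M j i
    rw [M.symmetric j i] at hgx
    have h1 : M i j ≠ 1 := M.off_diagonal i j hij
    rw [← hm] at *
    have e := Module.reflection_mul_reflection_pow_apply_self (coroot_self M i) (coroot_self M j)
      k _ ht
    have h' := congrArg (fun u : (B →₀ ℝ) ≃ₗ[ℝ] (B →₀ ℝ) => u (Finsupp.single i 1)) h
    simp only [geomRefl] at h'
    rw [e, hgx] at h'
    have hi := congrArg (fun u : B →₀ ℝ => u i) h'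
    have hj := congrArg (fun u : B →₀ ℝ => u j) h'
    simp only [Finsupp.add_apply, Finsupp.smul_apply, Finsupp.single_eq_same,
      Finsupp.single_eq_of_ne hij, Finsupp.single_eq_of_ne (Ne.symm hij), LinearEquiv.coe_one, id,
      smul_eq_mul, mul_one, mul_zero, add_zero, zero_add] at hi hj
    rcases Nat.lt_or_ge m 3 with h3 | h3
    · obtain rfl | rfl : m = 0 ∨ m = 2 := by omega
      · simp only [Nat.cast_zero, div_zero, mul_zero, Real.cos_zero, mul_one, S_eval_two] at hj
        push_cast at hj
        have : (k : ℝ) = 0 := by linarith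
        simpa using this
      · have e2 : 2 * (Real.pi / (2 : ℕ)) = Real.pi := by push_cast; ring
        rw [e2, Real.cos_pi, mul_neg_one, S_eval_neg_two, S_eval_neg_two] at hi
        rcases Nat.even_or_odd k with hk | hk
        · exact even_iff_two_dvd.1 hk
        · exfalso
          have hk' : Odd (k : ℤ) := by exact_mod_cast hk
          rw [Int.negOnePow_odd _ hk', Int.negOnePow_even _ (hk'.sub_odd odd_one)] at hi
          push_cast at hi
          norm_num at hi
    · have hs := sin_two_pi_div_pos h3
      have hm3 : (3 : ℝ) ≤ m := by exact_mod_cast h3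
      have hm0 : (m : ℝ) ≠ 0 := by positivity
      have hc : Real.cos (Real.pi / m) ≠ 0 := by
        apply ne_of_gt
        apply Real.cos_pos_of_mem_Ioo
        have hp := Real.pi_pos
        constructor
        · have : 0 < Real.pi / m := by positivity
          linarith
        · rw [div_lt_div_iff₀ (by linarith) (by norm_num)]
          nlinarith
      -- The coefficient of the root of `j` vanishes, so `sin (2 π k / m) = 0`; the coefficient of
      -- the root of `i` is `1`, so `cos (2 π k / m) = 1`.
      have z1 : (S ℝ ((k : ℤ) - 1)).eval (2 * Real.cos (2 * (Real.pi / m))) = 0 := by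
        refine (mul_eq_zero.1 hj).resolve_right ?_
        simpa using hc
      rw [z1, add_zero] at hi
      have a := S_two_mul_real_cos (2 * (Real.pi / m)) (k : ℤ)
      have b := S_two_mul_real_cos (2 * (Real.pi / m)) ((k : ℤ) - 1)
      rw [hi, one_mul] at a
      rw [z1, zero_mul] at b
      push_cast at a b
      rw [sub_add_cancel] at b
      rw [add_mul, one_mul, Real.sin_add, ← b, zero_mul, zero_add] at a
      have c : Real.cos (k * (2 * (Real.pi / m))) = 1 := by
        have : (Real.cos (k * (2 * (Real.pi / m))) - 1) * Real.sin (2 * (Real.pi / m)) = 0 := by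
          linarith
        linarith [(mul_eq_zero.1 this).resolve_right hs.ne']
      obtain ⟨n, hn⟩ := (Real.cos_eq_one_iff _).1 c
      have hnk : (n : ℝ) * m = k := by
        have hp := Real.pi_pos.ne'
        field_simp at hn
        linarith
      have : (m : ℤ) ∣ k := ⟨n, by rw [mul_comm]; exact_mod_cast hnk.symm⟩
      exact_mod_cast this

variable {M} {W : Type*} [Group W] (cs : CoxeterSystem M W)

/-- The order of `s_i s_j` in the Coxeter group is not a proper divisor of `m_{ij}`. -/
theorem dvd_of_simple_mul_pow_eq_one (i j : B) (k : ℕ)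
    (h : (cs.simple i * cs.simple j) ^ k = 1) : M i j ∣ k := by
  have h' := congrArg (cs.lift ⟨geomRefl M, geomRefl_mul_pow M⟩) h
  have hl : M.IsLiftable (geomRefl M) := geomRefl_mul_pow M
  change cs.lift ⟨geomRefl M, hl⟩ _ = _ at h'
  rw [map_pow, map_mul, map_one, cs.lift_apply_simple, cs.lift_apply_simple] at h'
  exact dvd_of_geomRefl_mul_pow_eq_one M i j k h'

end Geometric

/-! ### The strong exchange property -/

section Exchange

variable {B : Type*} {M : CoxeterMatrix B} {W : Type*} [Group W] (cs : CoxeterSystem M W)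

open Classical in
/-- The action of a simple reflection `s` on pairs of an element `t` and a sign: `t` is conjugated
by `s`, and the sign changes exactly if `t = s`. -/
def signedConj (i : B) : Function.End (W × ZMod 2) := fun p =>
  (cs.simple i * p.1 * cs.simple i, p.2 + if p.1 = cs.simple i then 1 else 0)

open Classical in
/-- Powers of `s_i s_j` acting by signed conjugation: the sign changes once for every reflection in
the alternating sequence `s_j, s_j s_i s_j, …` of length `2 n` that equals `t`. -/
theorem signedConj_mul_pow (i j : B) (n : ℕ) (t : W) (e : ZMod 2) :
    ((signedConj cs i * signedConj cs j) ^ n : Function.End (W × ZMod 2)) (t, e) =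
      ((cs.simple i * cs.simple j) ^ n * t * (cs.simple j * cs.simple i) ^ n,
        e + ∑ k ∈ Finset.range (2 * n),
          if t = (cs.simple j * cs.simple i) ^ k * cs.simple j then 1 else 0) := by
  induction n with
  | zero => simp; rfl
  | succ n ih =>
    set p := cs.simple j * cs.simple i with hp
    have hpi : cs.simple i * cs.simple j = p⁻¹ := by simp [hp]
    have hjp : ∀ k : ℕ, cs.simple j * (p⁻¹) ^ k = p ^ k * cs.simple j := by
      intro k
      induction k with
      | zero => simp
      | succ k ihk => rw [pow_succ, ← mul_assoc, ihk, pow_succ, ← hpi, hp]; group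
    rw [pow_succ']
    change (signedConj cs i) ((signedConj cs j)
      (((signedConj cs i * signedConj cs j) ^ n : Function.End (W × ZMod 2)) (t, e))) = _
    rw [ih, hpi]
    have e1 : ((p⁻¹) ^ n * t * p ^ n = cs.simple j) = (t = p ^ (2 * n) * cs.simple j) := by
      rw [two_mul, pow_add, mul_assoc (p ^ n) (p ^ n), ← hjp, eq_iff_iff]
      constructor
      · intro h; rw [← h]; group
      · intro h; rw [h]; group
    have e2 : (cs.simple j * ((p⁻¹) ^ n * t * p ^ n) * cs.simple j = cs.simple i) =
        (t = p ^ (2 * n + 1) * cs.simple j) := by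
      have : cs.simple j * cs.simple i * cs.simple j = p * cs.simple j := rfl
      have h3 : p ^ (2 * n + 1) * cs.simple j = p ^ n * (p * cs.simple j) * p⁻¹ ^ n := by
        rw [mul_assoc, mul_assoc, hjp, two_mul, ← mul_assoc, ← mul_assoc, ← pow_succ, ← pow_add]
        congr 2; omega
      rw [h3, ← this, eq_iff_iff]
      constructor
      · intro h; rw [← h]; simp [mul_assoc]
      · intro h; rw [h]; simp [mul_assoc]
    simp only [signedConj, e1, e2]
    rw [show 2 * (n + 1) = 2 * n + 1 + 1 by ring, Finset.sum_range_succ, Finset.sum_range_succ]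
    refine Prod.ext ?_ ?_
    · simp only [pow_succ p, pow_succ' p⁻¹]
      simp [hp, mul_assoc]
    · simp only [add_assoc]

/-- Over a full period the sequence of reflections runs through the same elements twice, so the
signs cancel. -/
theorem signedConj_liftable : M.IsLiftable (signedConj cs) := by
  classical
  intro i j
  funext ⟨t, e⟩
  rw [signedConj_mul_pow, two_mul, Finset.sum_range_add]
  have h : (cs.simple j * cs.simple i) ^ M i j = 1 := cs.simple_mul_simple_pow' i j
  simp [pow_add, h, CharTwo.add_self_eq_zero]
  rfl

/-- The action of `W` on pairs of an element and a sign. -/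
def signedAction : W →* Function.End (W × ZMod 2) := cs.lift ⟨_, signedConj_liftable cs⟩

/-- The sign cocycle: for a reflection `t` it is nonzero exactly if `t` is a right inversion
of `w`. -/
def invSign (w t : W) : ZMod 2 := (signedAction cs w (t, 0)).2

theorem signedAction_apply (w t : W) (e : ZMod 2) :
    signedAction cs w (t, e) = (w * t * w⁻¹, e + invSign cs w t) := by
  have key : ∀ w t, ∀ e : ZMod 2, (signedAction cs w (t, e)).1 = w * t * w⁻¹ ∧
      (signedAction cs w (t, e)).2 = e + (signedAction cs w (t, 0)).2 := by
    intro w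
    induction w using cs.simple_induction_left with
    | one => intro t e; rw [map_one]; constructor <;> simp [Function.End.one_def]
    | mul_simple_left w i ih =>
      intro t e
      rw [map_mul]
      have h : ∀ p, (signedAction cs (cs.simple i) * signedAction cs w) p =
          signedConj cs i (signedAction cs w p) := by
        intro p
        rw [signedAction, cs.lift_apply_simple]; rfl
      rw [h, h]
      obtain ⟨h1, h2⟩ := ih t e
      obtain ⟨h3, h4⟩ := ih t 0
      constructor
      · simp [signedConj, h1, mul_assoc]
      · simp only [signedConj, h2, add_assoc]
        rw [h1, h3]
  exact Prod.ext (key w t e).1 (key w t e).2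

theorem invSign_mul (w w' t : W) :
    invSign cs (w * w') t = invSign cs w' t + invSign cs w (w' * t * w'⁻¹) := by
  rw [invSign, map_mul]
  change (signedAction cs w (signedAction cs w' (t, 0))).2 = _
  rw [signedAction_apply, signedAction_apply, zero_add]

open Classical in
theorem invSign_simple (i : B) (t : W) :
    invSign cs (cs.simple i) t = if t = cs.simple i then 1 else 0 := by
  rw [invSign, signedAction, cs.lift_apply_simple]
  simp [signedConj]

theorem invSign_one (t : W) : invSign cs 1 t = 0 := by
  rw [invSign, map_one]; rfl

theorem invSign_self {t : W} (ht : cs.IsReflection t) : invSign cs t t = 1 := by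
  obtain ⟨w, i, rfl⟩ := ht
  have h := invSign_mul cs w w⁻¹ (w * cs.simple i * w⁻¹)
  rw [mul_inv_cancel, invSign_one] at h
  rw [invSign_mul cs (w * cs.simple i), invSign_mul cs w]
  have e : w⁻¹ * (w * cs.simple i * w⁻¹) * w⁻¹⁻¹ = cs.simple i := by group
  rw [e] at h ⊢
  have e2 : cs.simple i * cs.simple i * (cs.simple i)⁻¹ = cs.simple i := by group
  rw [e2, invSign_simple, if_pos rfl, add_left_comm, ← h, add_zero]

theorem mem_rightInvSeq_of_invSign_ne_zero (ω : List B) (t : W)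
    (h : invSign cs (cs.wordProd ω) t ≠ 0) : t ∈ cs.rightInvSeq ω := by
  induction ω with
  | nil => simp [invSign_one] at h
  | cons i ω ih =>
    rw [cs.wordProd_cons, invSign_mul, invSign_simple] at h
    rw [CoxeterSystem.rightInvSeq, List.mem_cons]
    by_cases h1 : cs.wordProd ω * t * (cs.wordProd ω)⁻¹ = cs.simple i
    · left; rw [← h1]; group
    · right; rw [if_neg h1, add_zero] at h; exact ih h

/-- The strong exchange property. -/
theorem strong_exchange (ω : List B) {t : W} (ht : cs.IsReflection t)
    (h : cs.length (cs.wordProd ω * t) < cs.length (cs.wordProd ω)) :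
    ∃ k < ω.length, cs.wordProd ω * t = cs.wordProd (ω.eraseIdx k) := by
  have h1 : invSign cs (cs.wordProd ω) t ≠ 0 := by
    intro h0
    have h2 : invSign cs (cs.wordProd ω * t) t ≠ 0 := by
      rw [invSign_mul, invSign_self cs ht, mul_inv_cancel_right, h0]; simp
    obtain ⟨ω', hω', he⟩ := cs.exists_isReduced (cs.wordProd ω * t)
    rw [he] at h2
    have h3 := (cs.isRightInversion_of_mem_rightInvSeq hω'
      (mem_rightInvSeq_of_invSign_ne_zero cs ω' t h2)).2
    rw [← he, mul_assoc, ht.mul_self, mul_one] at h3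
    omega
  obtain ⟨k, hk, rfl⟩ := List.mem_iff_getElem.1 (mem_rightInvSeq_of_invSign_ne_zero cs ω t h1)
  rw [← List.getD_eq_getElem _ 1 hk, cs.wordProd_mul_getD_rightInvSeq]
  exact ⟨k, by simpa using hk, rfl⟩

theorem exchange_left (ω : List B) (i : B)
    (h : cs.length (cs.simple i * cs.wordProd ω) < cs.length (cs.wordProd ω)) :
    ∃ k < ω.length, cs.simple i * cs.wordProd ω = cs.wordProd (ω.eraseIdx k) := by
  have e : cs.simple i * cs.wordProd ω = cs.wordProd ω *
    ((cs.wordProd ω)⁻¹ * cs.simple i * (cs.wordProd ω)⁻¹⁻¹) := by group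
  rw [e] at h ⊢
  exact strong_exchange cs ω ⟨_, i, rfl⟩ h

theorem length_eraseIdx_lt {ω : List B} {k : ℕ} (hk : k < ω.length) :
    cs.length (cs.wordProd (ω.eraseIdx k)) < ω.length := by
  have h1 := cs.length_wordProd_le (ω.eraseIdx k)
  have h2 := List.length_eraseIdx_add_one hk
  omega

/-- If `w < s w` and `w < w t`, but `s w t < s w`, then `s w = w t`. -/
theorem simple_mul_eq_mul_simple {w : W} {i j : B} (h1 : cs.length w < cs.length (cs.simple i * w))
    (h2 : cs.length w < cs.length (w * cs.simple j))
    (h3 : cs.length (cs.simple i * w * cs.simple j) < cs.length (cs.simple i * w)) :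
    cs.simple i * w = w * cs.simple j := by
  obtain ⟨ω, hω, rfl⟩ := cs.exists_isReduced w
  rw [← cs.wordProd_cons] at h3
  obtain ⟨k, hk, e⟩ := strong_exchange cs (i :: ω) (cs.isReflection_simple j) h3
  cases k with
  | zero =>
    rw [List.eraseIdx_cons_zero, cs.wordProd_cons] at e
    calc _ = cs.simple i * cs.wordProd ω * cs.simple j * cs.simple j := by simp
      _ = _ := by rw [e]
  | succ k =>
    exfalso
    rw [List.eraseIdx_cons_succ, cs.wordProd_cons, cs.wordProd_cons, mul_assoc, mul_right_inj] at e
    rw [e, hω.eq] at h2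
    have := length_eraseIdx_lt cs (ω := ω) (k := k) (by simpa using hk)
    omega

end Exchange

/-! ### Parabolic subgroups and minimal length representatives of cosets -/

section Parabolic

variable {B : Type*} {M : CoxeterMatrix B} {W : Type*} [Group W] (cs : CoxeterSystem M W)
  {I J : Set B}

theorem simple_mem_parabolic {i : B} (hi : i ∈ I) : cs.simple i ∈ parabolic cs I :=
  Subgroup.subset_closure ⟨i, hi, rfl⟩

theorem wordProd_mem_parabolic {ω : List B} (h : ∀ i ∈ ω, i ∈ I) :
    cs.wordProd ω ∈ parabolic cs I := by
  induction ω with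
  | nil => simp
  | cons i ω ih =>
    rw [cs.wordProd_cons]
    exact mul_mem (simple_mem_parabolic cs (h i (by simp))) (ih fun j hj => h j (by simp [hj]))

/-- Every element of a parabolic subgroup `W_I` has a reduced expression with letters in `I`. -/
theorem exists_isReduced_of_mem_parabolic {w : W} (hw : w ∈ parabolic cs I) :
    ∃ ω : List B, cs.IsReduced ω ∧ (∀ i ∈ ω, i ∈ I) ∧ w = cs.wordProd ω := by
  have step : ∀ i ∈ I, ∀ y : W,
      (∃ ω : List B, cs.IsReduced ω ∧ (∀ i ∈ ω, i ∈ I) ∧ y = cs.wordProd ω) →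
      ∃ ω : List B, cs.IsReduced ω ∧ (∀ i ∈ ω, i ∈ I) ∧ cs.simple i * y = cs.wordProd ω := by
    rintro i hi _ ⟨ω, hω, hωI, rfl⟩
    rcases cs.length_simple_mul (cs.wordProd ω) i with h | h
    · refine ⟨i :: ω, ?_, ?_, (cs.wordProd_cons i ω).symm⟩
      · rw [CoxeterSystem.IsReduced, cs.wordProd_cons, h, hω.eq, List.length_cons]
      · intro j hj
        rcases List.mem_cons.1 hj with rfl | hj
        exacts [hi, hωI j hj]
    · obtain ⟨k, hk, e⟩ := exchange_left cs ω i (by omega)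
      refine ⟨ω.eraseIdx k, ?_, fun j hj => hωI j (List.mem_of_mem_eraseIdx hj), e⟩
      have := List.length_eraseIdx_add_one hk
      rw [CoxeterSystem.IsReduced, ← e]
      have := hω.eq
      omega
  induction hw using Subgroup.closure_induction_left with
  | one => exact ⟨[], by simp [CoxeterSystem.IsReduced], by simp, by simp⟩
  | mul_left x hx y hy ih =>
    obtain ⟨i, hi, rfl⟩ := hx
    exact step i hi y ih
  | inv_mul_cancel x hx y hy ih =>
    obtain ⟨i, hi, rfl⟩ := hx
    rw [cs.inv_simple]
    exact step i hi y ih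

/-- Induction over a parabolic subgroup `W_I` along left multiplications by simple reflections
in `I` that increase the length. -/
theorem parabolic_induction {p : W → Prop} (one : p 1)
    (step : ∀ i ∈ I, ∀ u ∈ parabolic cs I, cs.length (cs.simple i * u) = cs.length u + 1 → p u →
      p (cs.simple i * u)) {w : W} (hw : w ∈ parabolic cs I) : p w := by
  obtain ⟨ω, hω, hωI, rfl⟩ := exists_isReduced_of_mem_parabolic cs hw
  clear hw
  induction ω with
  | nil => simpa using one
  | cons i ω ih =>
    have hr : cs.IsReduced ω := hω.drop 1
    have hωI' : ∀ j ∈ ω, j ∈ I := fun j hj => hωI j (by simp [hj])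
    rw [cs.wordProd_cons]
    refine step i (hωI i (by simp)) _ (wordProd_mem_parabolic cs hωI') ?_ (ih hr hωI')
    rw [← cs.wordProd_cons, hω.eq, hr.eq, List.length_cons]

theorem exists_simple_of_length_eq_one {w : W} (hw : w ∈ parabolic cs I)
    (h : cs.length w = 1) : ∃ i ∈ I, w = cs.simple i := by
  obtain ⟨ω, hω, hωI, rfl⟩ := exists_isReduced_of_mem_parabolic cs hw
  rw [hω.eq] at h
  obtain ⟨i, rfl⟩ := List.length_eq_one_iff.1 h
  exact ⟨i, hωI i (by simp), by simp⟩

theorem length_mul_of_mem_minLeft {x : W} (hx : x ∈ minLeft cs I) {u : W}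
    (hu : u ∈ parabolic cs I) : cs.length (u * x) = cs.length u + cs.length x := by
  refine parabolic_induction cs (p := fun u => cs.length (u * x) = cs.length u + cs.length x)
    (by simp) ?_ hu
  intro i hi u hu hl ih
  rcases cs.length_simple_mul (u * x) i with h | h
  · rw [mul_assoc, h, ih, hl]; omega
  · exfalso
    obtain ⟨ω₁, hω₁, rfl⟩ := cs.exists_isReduced u
    obtain ⟨ω₂, hω₂, rfl⟩ := cs.exists_isReduced x
    rw [← cs.wordProd_append] at h ih
    obtain ⟨k, hk, e⟩ := exchange_left cs (ω₁ ++ ω₂) i (by omega)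
    rcases Nat.lt_or_ge k ω₁.length with hk1 | hk1
    · rw [List.eraseIdx_append_of_lt_length hk1, cs.wordProd_append, cs.wordProd_append,
        ← mul_assoc, mul_left_inj] at e
      rw [e] at hl
      have := length_eraseIdx_lt cs hk1
      have := hω₁.eq
      omega
    · rw [List.eraseIdx_append_of_length_le hk1, cs.wordProd_append, cs.wordProd_append] at e
      have hk2 : k - ω₁.length < ω₂.length := by
        rw [List.length_append] at hk; omega
      have := hx ((cs.wordProd ω₁)⁻¹ * (cs.simple i * cs.wordProd ω₁))
        (mul_mem (inv_mem hu) (mul_mem (simple_mem_parabolic cs hi) hu))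
      rw [mul_assoc, mul_assoc, e, inv_mul_cancel_left] at this
      have h4 := length_eraseIdx_lt cs hk2
      have := hω₂.eq
      omega

theorem inv_mem_minRight {x : W} (hx : x ∈ minLeft cs I) : x⁻¹ ∈ minRight cs I := by
  intro w hw
  have h := hx w⁻¹ (inv_mem hw)
  rwa [← cs.length_inv x, ← cs.length_inv (w⁻¹ * x), mul_inv_rev, inv_inv] at h

theorem length_mul_of_mem_minRight {x : W} (hx : x ∈ minRight cs I) {u : W}
    (hu : u ∈ parabolic cs I) : cs.length (x * u) = cs.length x + cs.length u := by
  have h := length_mul_of_mem_minLeft cs (inv_mem_minLeft cs hx) (inv_mem hu)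
  rw [← mul_inv_rev, cs.length_inv, cs.length_inv, cs.length_inv] at h
  omega

theorem exists_minLeft_decomp (I : Set B) (w : W) :
    ∃ x ∈ minLeft cs I, ∃ u ∈ parabolic cs I, w = u * x := by
  let f : parabolic cs I → ℕ := fun u => cs.length ((u : W) * w)
  let u := Function.argmin f
  refine ⟨u * w, fun u' hu' => ?_, (u : W)⁻¹, inv_mem u.2, by simp⟩
  rw [← mul_assoc]
  exact Function.argmin_le f ⟨u' * u, mul_mem hu' u.2⟩

theorem minLeft_eq_of_mul_eq {x x' u u' : W} (hx : x ∈ minLeft cs I) (hx' : x' ∈ minLeft cs I)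
    (hu : u ∈ parabolic cs I) (hu' : u' ∈ parabolic cs I) (h : u * x = u' * x') : x = x' := by
  have h1 := length_mul_of_mem_minLeft cs hx (mul_mem (inv_mem hu') hu)
  have h2 := length_mul_of_mem_minLeft cs hx' (mul_mem (inv_mem hu) hu')
  have e1 : u'⁻¹ * u * x = x' := by rw [mul_assoc, h]; group
  have e2 : u⁻¹ * u' * x' = x := by rw [mul_assoc, ← h]; group
  rw [e1] at h1
  rw [e2] at h2
  have h3 : cs.length (u'⁻¹ * u) = 0 := by omega
  rw [cs.length_eq_zero_iff] at h3
  rw [← e1, h3, one_mul]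

/-- Minimality in the coset `W_I x` can be tested on the simple reflections in `I`. -/
theorem mem_minLeft_iff {x : W} :
    x ∈ minLeft cs I ↔ ∀ i ∈ I, cs.length x < cs.length (cs.simple i * x) := by
  constructor
  · intro hx i hi
    rw [length_mul_of_mem_minLeft cs hx (simple_mem_parabolic cs hi), cs.length_simple]
    omega
  · intro h
    obtain ⟨y, hy, u, hu, rfl⟩ := exists_minLeft_decomp cs I x
    by_cases hu1 : u = 1
    · rwa [hu1, one_mul]
    · exfalso
      obtain ⟨ω, hω, hωI, rfl⟩ := exists_isReduced_of_mem_parabolic cs hu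
      cases ω with
      | nil => simp at hu1
      | cons i ω =>
        have h1 := h i (hωI i (by simp))
        have hω' : ∀ j ∈ ω, j ∈ I := fun j hj => hωI j (by simp [hj])
        rw [cs.wordProd_cons, mul_assoc, cs.simple_mul_simple_cancel_left, ← mul_assoc,
          ← cs.wordProd_cons, length_mul_of_mem_minLeft cs hy hu,
          length_mul_of_mem_minLeft cs hy (wordProd_mem_parabolic cs hω'), hω.eq] at h1
        have := cs.length_wordProd_le ω
        rw [List.length_cons] at h1
        omega

/-- The element of `ᴵW` in the coset `W_I w`. -/
def minRep (I : Set B) (w : W) : minLeft cs I :=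
  ⟨(exists_minLeft_decomp cs I w).choose, (exists_minLeft_decomp cs I w).choose_spec.1⟩

theorem exists_mul_minRep (I : Set B) (w : W) :
    ∃ u ∈ parabolic cs I, w = u * (minRep cs I w : W) :=
  (exists_minLeft_decomp cs I w).choose_spec.2

theorem minRep_mul {u : W} (hu : u ∈ parabolic cs I) (w : W) :
    minRep cs I (u * w) = minRep cs I w := by
  obtain ⟨u1, hu1, e1⟩ := exists_mul_minRep cs I w
  obtain ⟨u2, hu2, e2⟩ := exists_mul_minRep cs I (u * w)
  refine Subtype.ext (minLeft_eq_of_mul_eq cs (minRep cs I (u * w)).2 (minRep cs I w).2 hu2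
    (mul_mem hu hu1) ?_)
  rw [← e2, mul_assoc, ← e1]

theorem minRep_of_mem {x : W} (hx : x ∈ minLeft cs I) : minRep cs I x = ⟨x, hx⟩ := by
  obtain ⟨u, hu, e⟩ := exists_mul_minRep cs I x
  exact Subtype.ext (minLeft_eq_of_mul_eq cs (minRep cs I x).2 hx hu (one_mem _)
    (by rw [← e, one_mul]))

theorem length_minRep_le (w : W) : cs.length (minRep cs I w : W) ≤ cs.length w := by
  obtain ⟨u, hu, e⟩ := exists_mul_minRep cs I w
  conv_rhs => rw [e]
  exact (minRep cs I w).2 u hu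

theorem mul_simple_mem_minLeft_of_lt {x : W} {j : B} (hx : x ∈ minLeft cs I)
    (h : cs.length (x * cs.simple j) < cs.length x) : x * cs.simple j ∈ minLeft cs I := by
  intro u hu
  have h1 := length_mul_of_mem_minLeft cs hx hu
  rw [← mul_assoc]
  rcases cs.length_mul_simple (u * x) j with h2 | h2 <;> omega

/-- Deodhar's lemma: for `x ∈ ᴵW` and a simple reflection `t`, either `x t ∈ ᴵW`, or `x < x t` and
`x t = s x` for some `s ∈ I`. -/
theorem mul_simple_mem_minLeft_or {x : W} (hx : x ∈ minLeft cs I) (j : B) :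
    x * cs.simple j ∈ minLeft cs I ∨
      ∃ i ∈ I, cs.simple i * x = x * cs.simple j ∧
        cs.length x < cs.length (x * cs.simple j) := by
  by_cases h : x * cs.simple j ∈ minLeft cs I
  · exact .inl h
  · have hlt : cs.length x < cs.length (x * cs.simple j) := by
      by_contra h'
      have := cs.length_mul_simple_ne x j
      exact h (mul_simple_mem_minLeft_of_lt cs hx (by omega))
    refine .inr ?_
    rw [mem_minLeft_iff] at h
    push Not at h
    obtain ⟨i, hi, h⟩ := h
    have h1 := (mem_minLeft_iff cs).1 hx i hi
    refine ⟨i, hi, simple_mul_eq_mul_simple cs h1 hlt ?_, hlt⟩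
    rw [← mul_assoc] at h
    have h2 := cs.length_mul_simple_ne (cs.simple i * x) j
    have h3 := cs.length_simple_mul x i
    have h4 := cs.length_mul_simple x j
    have h5 := cs.length_mul_simple (cs.simple i * x) j
    have h6 := cs.length_simple_mul_ne (x * cs.simple j) i
    rw [← mul_assoc] at h6
    omega

/-- For a regular double coset representative `z`, the products `z u` with `u ∈ W_I` all lie
in `ᴶW`. -/
theorem mul_mem_minLeft_of_regReps {z : W} (hz : z ∈ regReps cs J I) {u : W}
    (hu : u ∈ parabolic cs I) : z * u ∈ minLeft cs J := by
  obtain ⟨hzJ, hzI, hd⟩ := hz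
  suffices h : ∀ u ∈ parabolic cs I, z * u⁻¹ ∈ minLeft cs J by
    simpa using h u⁻¹ (inv_mem hu)
  clear hu u
  intro u hu
  refine parabolic_induction cs (p := fun u => z * u⁻¹ ∈ minLeft cs J) (by simpa using hzJ) ?_ hu
  intro i hi u hu hl ih
  rw [mul_inv_rev, cs.inv_simple, ← mul_assoc]
  rcases mul_simple_mem_minLeft_or cs ih i with h | ⟨j, hj, e, -⟩
  · exact h
  · exfalso
    have e' : cs.simple j * z = z * (u⁻¹ * cs.simple i * u) := by
      calc cs.simple j * z = cs.simple j * (z * u⁻¹) * u := by group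
        _ = _ := by rw [e]; group
    have hm : u⁻¹ * cs.simple i * u ∈ parabolic cs I :=
      mul_mem (mul_mem (inv_mem hu) (simple_mem_parabolic cs hi)) hu
    have h1 := length_mul_of_mem_minLeft cs hzJ (simple_mem_parabolic cs hj)
    rw [e', length_mul_of_mem_minRight cs hzI hm, cs.length_simple] at h1
    obtain ⟨i', hi', e''⟩ := exists_simple_of_length_eq_one cs hm (by omega)
    rw [e''] at e'
    refine Set.disjoint_left.1 hd ⟨j, hj, rfl⟩ ⟨cs.simple i', ⟨i', hi', rfl⟩, ?_⟩
    change z * cs.simple i' * z⁻¹ = _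
    rw [← e']; group

theorem longest_mem (hI : Finite (parabolic cs I)) : longest cs I hI ∈ parabolic cs I :=
  (exists_longest cs I hI).choose_spec.1

theorem length_le_longest (hI : Finite (parabolic cs I)) {u : W} (hu : u ∈ parabolic cs I) :
    cs.length u ≤ cs.length (longest cs I hI) :=
  (exists_longest cs I hI).choose_spec.2 u hu

/-- An element of `ᴵW` whose inverse is not a regular double coset representative admits
`s ∈ J` for which either `x s < x`, or `x s = t x > x` with `t ∈ I`. -/
theorem exists_simple_of_not_regReps {x : W} (hx : x ∈ minLeft cs I)
    (h : x⁻¹ ∉ regReps cs J I) :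
    ∃ j ∈ J, cs.length (x * cs.simple j) < cs.length x ∨
      (cs.length x < cs.length (x * cs.simple j) ∧ ∃ i ∈ I, cs.simple i * x = x * cs.simple j) := by
  by_contra hcon
  push Not at hcon
  have hup : ∀ j ∈ J, cs.length x < cs.length (x * cs.simple j) := fun j hj =>
    lt_of_le_of_ne (hcon j hj).1 (cs.length_mul_simple_ne x j).symm
  refine h ⟨?_, inv_mem_minRight cs hx, ?_⟩
  · rw [mem_minLeft_iff]
    intro j hj
    have := hup j hj
    rw [← cs.length_inv (_ * _)]
    simpa using this
  · rw [Set.disjoint_left]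
    rintro _ ⟨j, hj, rfl⟩ ⟨_, ⟨i, hi, rfl⟩, e⟩
    refine (hcon j hj).2 (hup j hj) i hi ?_
    rw [← e]; group

end Parabolic

/-! ### The Bruhat order -/

section Bruhat

variable {B : Type*} {M : CoxeterMatrix B} {W : Type*} [Group W] (cs : CoxeterSystem M W)
  {I : Set B}

theorem BruhatLT.trans {x y z : W} (h1 : BruhatLT cs x y) (h2 : BruhatLT cs y z) :
    BruhatLT cs x z := Relation.TransGen.trans h1 h2

theorem BruhatLT.length_lt {x y : W} (h : BruhatLT cs x y) : cs.length x < cs.length y := by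
  induction h with
  | single h => obtain ⟨t, -, -, h⟩ := h; exact h
  | tail _ h ih => obtain ⟨t, -, -, h⟩ := h; exact ih.trans h

theorem bruhatLT_mul_simple {x : W} {j : B} (h : cs.length x < cs.length (x * cs.simple j)) :
    BruhatLT cs x (x * cs.simple j) :=
  .single ⟨_, cs.isReflection_simple j, rfl, h⟩

theorem bruhatLT_simple_mul {x : W} {i : B} (h : cs.length x < cs.length (cs.simple i * x)) :
    BruhatLT cs x (cs.simple i * x) :=
  .single ⟨x⁻¹ * cs.simple i * x⁻¹⁻¹, ⟨_, _, rfl⟩, by group, h⟩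

/-- Passing to the minimal representative of a coset does not increase an element in the Bruhat
order. -/
theorem minRep_eq_or_bruhatLT (w : W) :
    (minRep cs I w : W) = w ∨ BruhatLT cs (minRep cs I w) w := by
  obtain ⟨u, hu, e⟩ := exists_mul_minRep cs I w
  generalize minRep cs I w = x at e
  subst e
  refine parabolic_induction cs (p := fun u => (x : W) = u * x ∨ BruhatLT cs (x : W) (u * x))
    (by simp) ?_ hu
  intro i hi u hu hl ih
  right
  have h1 := length_mul_of_mem_minLeft cs x.2 hu
  have h2 := length_mul_of_mem_minLeft cs x.2 (mul_mem (simple_mem_parabolic cs hi) hu)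
  have h3 : BruhatLT cs (u * x) (cs.simple i * u * x) := by
    rw [mul_assoc]
    apply bruhatLT_simple_mul
    rw [← mul_assoc]; omega
  rcases ih with ih | ih
  · rwa [← ih] at h3
  · exact ih.trans cs h3

/-- The lifting property for an elementary step `u < w = u t` of the Bruhat order: if multiplication
by `s_j` reverses the step, the strong exchange property forces `t = s_j`. -/
theorem bruhat_step_mul_simple {u w t : W} (j : B) (ht : cs.IsReflection t) (hw : w = u * t)
    (hl : cs.length u < cs.length w) :
    u * cs.simple j = w ∨ BruhatLT cs (u * cs.simple j) (w * cs.simple j) ∨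
      BruhatLT cs (u * cs.simple j) w := by
  have ht' : cs.IsReflection (cs.simple j * t * (cs.simple j)⁻¹) := ht.conj _
  have e : w * cs.simple j = u * cs.simple j * (cs.simple j * t * (cs.simple j)⁻¹) := by
    rw [hw]; simp [mul_assoc]
  rcases lt_trichotomy (cs.length (u * cs.simple j)) (cs.length (w * cs.simple j)) with h | h | h
  · exact .inr (.inl (.single ⟨_, ht', e, h⟩))
  · exact absurd (e ▸ h.symm) (ht'.length_mul_left_ne _)
  · left
    have h1 := cs.length_mul_simple u j
    have h2 := cs.length_mul_simple w j
    obtain ⟨ω, hω, hwω⟩ := cs.exists_isReduced (w * cs.simple j)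
    have hw' : w = cs.wordProd (ω ++ [j]) := by
      rw [cs.wordProd_append, ← hwω, cs.wordProd_singleton, cs.simple_mul_simple_cancel_right]
    have hu : u = w * t := by rw [hw, mul_assoc, ht.mul_self, mul_one]
    obtain ⟨k, hk, ek⟩ := strong_exchange cs (ω ++ [j]) ht (by rw [← hw', ← hu]; exact hl)
    rw [← hw', ← hu] at ek
    have hlω := hω.eq
    rw [← hwω] at hlω
    rcases Nat.lt_or_ge k ω.length with hk1 | hk1
    · exfalso
      rw [List.eraseIdx_append_of_lt_length hk1, cs.wordProd_append, cs.wordProd_singleton] at ek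
      have h3 := length_eraseIdx_lt cs hk1
      rw [ek, cs.simple_mul_simple_cancel_right] at h h1
      rw [ek] at hl
      omega
    · have hk2 : k = ω.length := by simp at hk; omega
      rw [hk2, List.eraseIdx_append_of_length_le le_rfl] at ek
      rw [ek, hw']; simp [cs.wordProd_append]

/-- The lifting property of the Bruhat order. -/
theorem bruhat_mul_simple {u w : W} (h : BruhatLT cs u w) (j : B) :
    u * cs.simple j = w ∨ BruhatLT cs (u * cs.simple j) (w * cs.simple j) ∨
      BruhatLT cs (u * cs.simple j) w := by
  induction h with
  | single h =>
    obtain ⟨t, ht, e, hl⟩ := h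
    exact bruhat_step_mul_simple cs j ht e hl
  | @tail y w _ h ih =>
    obtain ⟨t, ht, e, hl⟩ := h
    have hyw : BruhatLT cs y w := .single ⟨t, ht, e, hl⟩
    rcases ih with ih | ih | ih
    · right; right; rw [ih]; exact hyw
    · rcases bruhat_step_mul_simple cs j ht e hl with h | h | h
      · right; right; rwa [h] at ih
      · right; left; exact ih.trans cs h
      · right; right; exact ih.trans cs h
    · right; right; exact ih.trans cs hyw

theorem bruhat_mul_simple_of_lt {u w : W} (h : BruhatLT cs u w) {j : B}
    (hw : cs.length w < cs.length (w * cs.simple j)) :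
    BruhatLT cs (u * cs.simple j) (w * cs.simple j) := by
  rcases bruhat_mul_simple cs h j with h | h | h
  · rw [h]; exact bruhatLT_mul_simple cs hw
  · exact h
  · exact h.trans cs (bruhatLT_mul_simple cs hw)

end Bruhat

/-! ### Braid words and Matsumoto's theorem -/

section Dihedral

theorem altProd_two_mul {A : Type*} [Monoid A] (a b : A) (n : ℕ) :
    altProd a b (2 * n) = (a * b) ^ n := by
  induction n with
  | zero => simp [altProd]
  | succ n ih =>
    rw [show 2 * (n + 1) = 2 * n + 1 + 1 by ring, altProd, altProd, ih, pow_succ', mul_assoc]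

theorem altProd_add {A : Type*} [Monoid A] (m n : ℕ) : ∀ a b : A,
    altProd a b (m + n) = altProd a b m * if Even m then altProd a b n else altProd b a n := by
  induction m with
  | zero => simp [altProd]
  | succ m ih =>
    intro a b
    rw [show m + 1 + n = m + n + 1 by ring, altProd, ih, altProd, mul_assoc]
    by_cases h : Even m <;> simp [h, Nat.even_add_one]

/-- For involutions `a` and `b`, the braid relation of length `n` reads `(a b) ^ n = 1`. -/
theorem altProd_eq_swap_iff {G : Type*} [Group G] {a b : G} (ha : a⁻¹ = a) (hb : b⁻¹ = b) (n : ℕ) :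
    altProd a b n = altProd b a n ↔ (a * b) ^ n = 1 := by
  have h : altProd a b n * (altProd b a n)⁻¹ = (a * b) ^ n := by
    rw [← altProd_two_mul, two_mul, altProd_add, inv_altProd, ha, hb]
  rw [← h, mul_inv_eq_one]

theorem altProd_commute {A : Type*} [Monoid A] {c : A} (n : ℕ) : ∀ {a b : A}, Commute c a →
    Commute c b → Commute c (altProd a b n) := by
  induction n with
  | zero => intro a b _ _; exact Commute.one_right c
  | succ n ih => intro a b ha hb; exact ha.mul_right (ih hb ha)

/-- The alternating word `i j i ⋯` with `n` letters. -/
def altWord {B : Type*} (i j : B) : ℕ → List B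
  | 0 => []
  | n + 1 => i :: altWord j i n

theorem length_altWord {B : Type*} (n : ℕ) : ∀ i j : B, (altWord i j n).length = n := by
  induction n with
  | zero => intro i j; rfl
  | succ n ih => intro i j; rw [altWord, List.length_cons, ih]

theorem prod_map_altWord {B A : Type*} [Monoid A] (f : B → A) (n : ℕ) :
    ∀ i j : B, ((altWord i j n).map f).prod = altProd (f i) (f j) n := by
  induction n with
  | zero => intro i j; simp [altWord, altProd]
  | succ n ih => intro i j; rw [altWord, List.map_cons, List.prod_cons, ih, altProd]

variable {B : Type*} {M : CoxeterMatrix B} {W : Type*} [Group W] (cs : CoxeterSystem M W)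

theorem length_altProd_le (n : ℕ) (i j : B) :
    cs.length (altProd (cs.simple i) (cs.simple j) n) ≤ n := by
  have h := cs.length_wordProd_le (altWord i j n)
  rwa [length_altWord, CoxeterSystem.wordProd, prod_map_altWord] at h

/-- A reduced word in two letters is alternating. -/
theorem wordProd_eq_altProd {ω : List B} : ∀ {i j : B}, cs.IsReduced (i :: ω) →
    (∀ k ∈ ω, k = i ∨ k = j) →
    cs.wordProd (i :: ω) = altProd (cs.simple i) (cs.simple j) (ω.length + 1) := by
  induction ω with
  | nil => intro i j _ _; simp [altProd]
  | cons k ω ih =>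
    intro i j hr hk
    have hki : k ≠ i := by
      rintro rfl
      have h := hr.eq
      rw [cs.wordProd_cons, cs.wordProd_cons, cs.simple_mul_simple_cancel_left] at h
      have := cs.length_wordProd_le ω
      simp only [List.length_cons] at h
      omega
    obtain rfl : k = j := (hk k (by simp)).resolve_left hki
    rw [cs.wordProd_cons, ih (i := k) (j := i) (hr.drop 1)
      fun l hl => (hk l (by simp [hl])).symm, List.length_cons]
    rfl

theorem altProd_simple_comm (i j : B) : altProd (cs.simple i) (cs.simple j) (M i j) =
    altProd (cs.simple j) (cs.simple i) (M i j) :=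
  (altProd_eq_swap_iff (cs.inv_simple i) (cs.inv_simple j) _).2 (cs.simple_mul_simple_pow i j)

/-- An element of a dihedral parabolic subgroup with left descent `s_i` is the alternating product
that starts with `s_i`. -/
theorem eq_altProd_of_descent {i j : B} {d : W} (hd : d ∈ parabolic cs {i, j})
    (h : cs.length (cs.simple i * d) < cs.length d) :
    d = altProd (cs.simple i) (cs.simple j) (cs.length d) := by
  have h1 : cs.simple i * d ∈ parabolic cs {i, j} :=
    mul_mem (simple_mem_parabolic cs (by simp)) hd
  obtain ⟨ω, hω, hωI, e⟩ := exists_isReduced_of_mem_parabolic cs h1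
  have e' : d = cs.wordProd (i :: ω) := by
    rw [cs.wordProd_cons, ← e, cs.simple_mul_simple_cancel_left]
  have hl : cs.length d = ω.length + 1 := by
    have h2 := cs.length_simple_mul d i
    have h3 := hω.eq
    rw [← e] at h3
    omega
  have hr : cs.IsReduced (i :: ω) := by
    rw [CoxeterSystem.IsReduced, ← e', hl, List.length_cons]
  conv_lhs => rw [e', wordProd_eq_altProd cs hr hωI]
  rw [hl]

/-- An element for which both `s_i` and `s_j` are left descents has a reduced expression that
starts with the braid word of `i, j`. -/
theorem exists_eq_altProd_mul {i j : B} {w : W}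
    (hi : cs.length (cs.simple i * w) < cs.length w)
    (hj : cs.length (cs.simple j * w) < cs.length w) :
    ∃ x, M i j ≠ 0 ∧ w = altProd (cs.simple i) (cs.simple j) (M i j) * x ∧
      cs.length w = M i j + cs.length x := by
  obtain ⟨x, hx, d, hd, rfl⟩ := exists_minLeft_decomp cs {i, j} w
  have hmi : cs.simple i ∈ parabolic cs {i, j} := simple_mem_parabolic cs (by simp)
  have hmj : cs.simple j ∈ parabolic cs {i, j} := simple_mem_parabolic cs (by simp)
  rw [← mul_assoc, length_mul_of_mem_minLeft cs hx hd,
    length_mul_of_mem_minLeft cs hx (mul_mem ‹_› hd)] at hi hj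
  have ei := eq_altProd_of_descent cs hd (by omega)
  have ej := eq_altProd_of_descent cs (i := j) (j := i) (d := d)
    (by rwa [Set.pair_comm]) (by omega)
  have hpow := (altProd_eq_swap_iff (cs.inv_simple i) (cs.inv_simple j) _).1 (ei.symm.trans ej)
  have hdvd := dvd_of_simple_mul_pow_eq_one cs i j _ hpow
  have hpos : 0 < cs.length d := by omega
  have hM : M i j ≠ 0 := fun h0 => by rw [h0, zero_dvd_iff] at hdvd; omega
  have hle : M i j ≤ cs.length d := Nat.le_of_dvd hpos hdvd
  have hge : cs.length d ≤ M i j := by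
    -- Otherwise the expression of `d` begins with a braid word and one more letter, which
    -- can be shortened by the braid relation.
    by_contra hlt
    obtain ⟨m, hm⟩ : ∃ m, M i j = m + 1 := Nat.exists_eq_succ_of_ne_zero hM
    obtain ⟨k, hk⟩ : ∃ k, cs.length d = m + 1 + 1 + k := ⟨cs.length d - (m + 1 + 1), by omega⟩
    have hb := altProd_simple_comm cs i j
    rw [hm] at hb
    have h1 : altProd (cs.simple i) (cs.simple j) (m + 1 + 1) =
        altProd (cs.simple j) (cs.simple i) m := by
      rw [altProd, ← hb, altProd, cs.simple_mul_simple_cancel_left]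
    rw [hk, altProd_add, h1] at ei
    have h2 := cs.length_mul_le (altProd (cs.simple j) (cs.simple i) m)
      (if Even (m + 1 + 1) then altProd (cs.simple i) (cs.simple j) k
        else altProd (cs.simple j) (cs.simple i) k)
    rw [← ei] at h2
    have h3 := length_altProd_le cs m j i
    have h4 : cs.length (if Even (m + 1 + 1) then altProd (cs.simple i) (cs.simple j) k
        else altProd (cs.simple j) (cs.simple i) k) ≤ k := by
      split_ifs
      exacts [length_altProd_le cs k i j, length_altProd_le cs k j i]
    omega
  have heq : cs.length d = M i j := le_antisymm hge hle
  refine ⟨x, hM, ?_, ?_⟩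
  · rw [← heq, ← ei]
  · rw [length_mul_of_mem_minLeft cs hx hd, heq]

/-- Alternating words with at most `m_{ij}` letters are reduced. -/
theorem length_altProd {i j : B} (n : ℕ) (hn : n ≤ M i j) :
    cs.length (altProd (cs.simple i) (cs.simple j) n) = n := by
  induction n generalizing i j with
  | zero => simp [altProd]
  | succ n ih =>
    have hsym := M.symmetric i j
    have ih' := ih (i := j) (j := i) (by omega)
    rw [altProd]
    rcases cs.length_simple_mul (altProd (cs.simple j) (cs.simple i) n) i with h | h
    · rw [h, ih']
    · exfalso
      have h2 : cs.length (cs.simple j * altProd (cs.simple j) (cs.simple i) n) <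
          cs.length (altProd (cs.simple j) (cs.simple i) n) := by
        cases n with
        | zero => simp [altProd] at h
        | succ n =>
          rw [ih', altProd, cs.simple_mul_simple_cancel_left]
          have := length_altProd_le cs n i j
          omega
      obtain ⟨x, -, -, hx⟩ := exists_eq_altProd_mul cs (i := i) (j := j) (by omega) h2
      omega

/-- Matsumoto's theorem: if elements of a monoid satisfy the braid relations, then their products
along reduced words depend only on the element that the word represents. -/
theorem matsumoto {A : Type*} [Monoid A] (f : B → A)
    (hf : ∀ i j, altProd (f i) (f j) (M i j) = altProd (f j) (f i) (M i j)) {ω ω' : List B}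
    (hω : cs.IsReduced ω) (hω' : cs.IsReduced ω') (h : cs.wordProd ω = cs.wordProd ω') :
    (ω.map f).prod = (ω'.map f).prod := by
  obtain ⟨n, hn⟩ : ∃ n, ω.length = n := ⟨_, rfl⟩
  have hn' : ω'.length = n := by rw [← hω'.eq, ← h, hω.eq, hn]
  induction n generalizing ω ω' with
  | zero =>
    rw [List.eq_nil_of_length_eq_zero hn, List.eq_nil_of_length_eq_zero hn']
  | succ n ih =>
    obtain ⟨i, α, rfl⟩ : ∃ i α, ω = i :: α := List.exists_cons_of_length_eq_add_one hn
    obtain ⟨j, β, rfl⟩ : ∃ j β, ω' = j :: β := List.exists_cons_of_length_eq_add_one hn'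
    have hα : cs.IsReduced α := hω.drop 1
    have hβ : cs.IsReduced β := hω'.drop 1
    rw [List.length_cons, add_left_inj] at hn hn'
    by_cases hij : i = j
    · subst hij
      rw [cs.wordProd_cons, cs.wordProd_cons, mul_right_inj] at h
      rw [List.map_cons, List.map_cons, List.prod_cons, List.prod_cons, ih hα hβ h hn hn']
    · have hi : cs.length (cs.simple i * cs.wordProd (i :: α)) <
          cs.length (cs.wordProd (i :: α)) := by
        rw [hω.eq, cs.wordProd_cons, cs.simple_mul_simple_cancel_left, hα.eq]; simp
      have hj : cs.length (cs.simple j * cs.wordProd (i :: α)) <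
          cs.length (cs.wordProd (i :: α)) := by
        rw [h, hω'.eq, cs.wordProd_cons, cs.simple_mul_simple_cancel_left, hβ.eq]; simp
      obtain ⟨x, hM, e, hl⟩ := exists_eq_altProd_mul cs hi hj
      obtain ⟨m, hm⟩ : ∃ m, M i j = m + 1 := Nat.exists_eq_succ_of_ne_zero hM
      obtain ⟨ξ, hξ, rfl⟩ := cs.exists_isReduced x
      rw [hω.eq, hξ.eq, List.length_cons, hm] at hl
      -- Replace the tail of a reduced word starting with `k` by the tail of the braid word.
      have key : ∀ {k l : B} {γ : List B}, cs.IsReduced γ → γ.length = n →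
          cs.wordProd (k :: γ) = altProd (cs.simple k) (cs.simple l) (m + 1) * cs.wordProd ξ →
          ((k :: γ).map f).prod = altProd (f k) (f l) (m + 1) * (ξ.map f).prod := by
        intro k l γ hγ hγn hγe
        rw [cs.wordProd_cons, altProd, mul_assoc, mul_right_inj] at hγe
        have e3 : cs.wordProd (altWord l k m ++ ξ) = cs.wordProd γ := by
          rw [cs.wordProd_append, hγe, CoxeterSystem.wordProd, prod_map_altWord]
        have hr : cs.IsReduced (altWord l k m ++ ξ) := by
          rw [CoxeterSystem.IsReduced, e3, hγ.eq, List.length_append, length_altWord]; omega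
        rw [List.map_cons, List.prod_cons, ih hγ hr e3.symm hγn
          (by rw [List.length_append, length_altWord]; omega), List.map_append, List.prod_append,
          prod_map_altWord, altProd, mul_assoc]
      rw [key (l := j) hα hn (by rw [e, hm]), key (l := i) hβ hn'
        (by rw [← h, e, altProd_simple_comm, hm]), ← hm, hf]

end Dihedral

/-! ### The standard basis of the Hecke algebra -/

section HeckeBasis

variable {B : Type*} {M : CoxeterMatrix B} {W : Type*} [Group W] (cs : CoxeterSystem M W)

theorem stdHecke_wordProd {ω : List B} (hω : cs.IsReduced ω) :
    stdHecke cs (cs.wordProd ω) = (ω.map (gen M)).prod :=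
  matsumoto cs (gen M) (gen_braid M) (cs.exists_isReduced _).choose_spec.1 hω
    (cs.exists_isReduced (cs.wordProd ω)).choose_spec.2.symm

theorem stdHecke_one : stdHecke cs (1 : W) = 1 := by
  have h := stdHecke_wordProd cs (ω := []) (by simp [CoxeterSystem.IsReduced])
  simpa using h

/-- `H_{xy} = H_x H_y` if the lengths of `x` and `y` add up. -/
theorem stdHecke_mul {x y : W} (h : cs.length (x * y) = cs.length x + cs.length y) :
    stdHecke cs (x * y) = stdHecke cs x * stdHecke cs y := by
  obtain ⟨ω₁, h₁, rfl⟩ := cs.exists_isReduced x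
  obtain ⟨ω₂, h₂, rfl⟩ := cs.exists_isReduced y
  have h₃ : cs.IsReduced (ω₁ ++ ω₂) := by
    rw [CoxeterSystem.IsReduced, cs.wordProd_append, h, h₁.eq, h₂.eq, List.length_append]
  rw [← cs.wordProd_append, stdHecke_wordProd cs h₃, stdHecke_wordProd cs h₁,
    stdHecke_wordProd cs h₂, List.map_append, List.prod_append]

theorem stdHecke_simple (i : B) : stdHecke cs (cs.simple i) = gen M i := by
  have h := stdHecke_wordProd cs (ω := [i]) (by simp [CoxeterSystem.IsReduced])
  simpa using h

theorem gen_mul_stdHecke {i : B} {w : W} (h : cs.length (cs.simple i * w) = cs.length w + 1) :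
    gen M i * stdHecke cs w = stdHecke cs (cs.simple i * w) := by
  rw [stdHecke_mul cs (by rw [h, cs.length_simple, add_comm]), stdHecke_simple]

theorem stdHecke_mul_gen {i : B} {w : W} (h : cs.length (w * cs.simple i) = cs.length w + 1) :
    stdHecke cs w * gen M i = stdHecke cs (w * cs.simple i) := by
  rw [stdHecke_mul cs (by rw [h, cs.length_simple]), stdHecke_simple]

theorem gen_mul_gen (i : B) : gen M i * gen M i = 1 + (vInv - v) • gen M i := by
  have h := (genUnit M i).val_inv
  change gen M i * (gen M i + algebraMap LZ _ (v - vInv)) = 1 at h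
  rw [mul_add, ← Algebra.commutes, ← Algebra.smul_def] at h
  rw [← h, add_assoc, ← add_smul]
  simp

theorem gen_mul_stdHecke' {i : B} {w : W} (h : cs.length (cs.simple i * w) + 1 = cs.length w) :
    gen M i * stdHecke cs w = stdHecke cs (cs.simple i * w) + (vInv - v) • stdHecke cs w := by
  have e : stdHecke cs w = gen M i * stdHecke cs (cs.simple i * w) := by
    rw [gen_mul_stdHecke cs (by rw [cs.simple_mul_simple_cancel_left, h]),
      cs.simple_mul_simple_cancel_left]
  conv_lhs => rw [e, ← mul_assoc, gen_mul_gen, add_mul, one_mul, smul_mul_assoc, ← e]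

theorem stdHecke_mul_gen' {i : B} {w : W} (h : cs.length (w * cs.simple i) + 1 = cs.length w) :
    stdHecke cs w * gen M i = stdHecke cs (w * cs.simple i) + (vInv - v) • stdHecke cs w := by
  have e : stdHecke cs w = stdHecke cs (w * cs.simple i) * gen M i := by
    rw [stdHecke_mul_gen cs (by rw [cs.simple_mul_simple_cancel_right, h]),
      cs.simple_mul_simple_cancel_right]
  conv_lhs => rw [e, mul_assoc, gen_mul_gen, mul_add, mul_one, mul_smul_comm, ← e]

theorem mul_mem_of_gen_mul_mem (S : Submodule LZ (HeckeAlgebra M))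
    (hS : ∀ i, ∀ x ∈ S, gen M i * x ∈ S) (h : HeckeAlgebra M) : ∀ x ∈ S, h * x ∈ S := by
  obtain ⟨a, rfl⟩ := mk_surjective M h
  induction a using FreeAlgebra.induction with
  | grade0 r => intro x hx; rw [AlgHom.commutes, ← Algebra.smul_def]; exact S.smul_mem r hx
  | grade1 s => exact hS s
  | mul a b ha hb => intro x hx; rw [map_mul, mul_assoc]; exact ha _ (hb _ hx)
  | add a b ha hb => intro x hx; rw [map_add, add_mul]; exact S.add_mem (ha _ hx) (hb _ hx)

theorem span_stdHecke : Submodule.span LZ (Set.range (stdHecke cs)) = ⊤ := by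
  rw [eq_top_iff]
  intro h _
  have h1 : (1 : HeckeAlgebra M) ∈ Submodule.span LZ (Set.range (stdHecke cs)) :=
    Submodule.subset_span ⟨1, stdHecke_one cs⟩
  have := mul_mem_of_gen_mul_mem (Submodule.span LZ (Set.range (stdHecke cs))) ?_ h 1 h1
  · rwa [mul_one] at this
  · intro i x hx
    induction hx using Submodule.span_induction with
    | mem x hx =>
      obtain ⟨w, rfl⟩ := hx
      rcases cs.length_simple_mul w i with h | h
      · rw [gen_mul_stdHecke cs h]; exact Submodule.subset_span ⟨_, rfl⟩
      · rw [gen_mul_stdHecke' cs h]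
        exact add_mem (Submodule.subset_span ⟨_, rfl⟩)
          (Submodule.smul_mem _ _ (Submodule.subset_span ⟨_, rfl⟩))
    | zero => rw [mul_zero]; exact zero_mem _
    | add x y _ _ hx hy => rw [mul_add]; exact add_mem hx hy
    | smul r x _ hx => rw [mul_smul_comm]; exact Submodule.smul_mem _ _ hx

/-- The coefficient of `H_w` in `H_s H_w`: it is `v⁻¹ - v` if `s w < w`, and `0` otherwise. -/
def leftCoeff (i : B) (w : W) : LZ :=
  if cs.length (cs.simple i * w) < cs.length w then vInv - v else 0

/-- The coefficient of `H_w` in `H_w H_s`: it is `v⁻¹ - v` if `w s < w`, and `0` otherwise. -/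
def rightCoeff (i : B) (w : W) : LZ :=
  if cs.length (w * cs.simple i) < cs.length w then vInv - v else 0

/-- Left multiplication by `H_s` on the free module with basis `W`. -/
def leftOp (i : B) : Module.End LZ (W →₀ LZ) :=
  Finsupp.linearCombination LZ fun w =>
    Finsupp.single (cs.simple i * w) 1 + leftCoeff cs i w • Finsupp.single w 1

/-- Right multiplication by `H_s` on the free module with basis `W`. -/
def rightOp (i : B) : Module.End LZ (W →₀ LZ) :=
  Finsupp.linearCombination LZ fun w =>
    Finsupp.single (w * cs.simple i) 1 + rightCoeff cs i w • Finsupp.single w 1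

theorem leftOp_single (i : B) (w : W) : leftOp cs i (Finsupp.single w 1) =
    Finsupp.single (cs.simple i * w) 1 + leftCoeff cs i w • Finsupp.single w 1 := by
  simp [leftOp]

theorem leftOp_apply (i : B) (e : W →₀ LZ) (u : W) :
    leftOp cs i e u = e (cs.simple i * u) + leftCoeff cs i u * e u := by
  classical
  induction e using Finsupp.induction_linear with
  | zero => simp
  | add f g hf hg =>
    rw [map_add, Finsupp.add_apply, hf, hg, Finsupp.add_apply, Finsupp.add_apply]; ring
  | single w r =>
    have : Finsupp.single w r = r • Finsupp.single w (1 : LZ) := by simp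
    rw [this, map_smul, leftOp_single]
    simp only [Finsupp.smul_apply, Finsupp.add_apply, Finsupp.single_apply, smul_eq_mul]
    have h : (cs.simple i * w = u) = (w = cs.simple i * u) := by
      rw [eq_iff_iff]
      constructor
      · rintro rfl; simp
      · rintro rfl; simp
    rw [h]
    by_cases hw : w = u
    · subst hw; ring
    · simp [hw]

theorem rightOp_single (i : B) (w : W) : rightOp cs i (Finsupp.single w 1) =
    Finsupp.single (w * cs.simple i) 1 + rightCoeff cs i w • Finsupp.single w 1 := by
  simp [rightOp]

theorem end_ext_single {X : Type*} {T T' : Module.End LZ (X →₀ LZ)}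
    (h : ∀ w, T (Finsupp.single w 1) = T' (Finsupp.single w 1)) : T = T' := by
  refine Finsupp.lhom_ext' fun w => LinearMap.ext_ring ?_
  exact h w

/-- Left and right multiplication commute on the free module. This has to be checked on basis
elements, since associativity is not available there; the only delicate case is `s w = w t`. -/
theorem rightOp_commute_leftOp (i j : B) : Commute (rightOp cs j) (leftOp cs i) := by
  refine end_ext_single fun w => ?_
  simp only [Module.End.mul_apply, leftOp_single, rightOp_single, map_add, map_smul, smul_add]
  have h1 := cs.length_simple_mul w i
  have h2 := cs.length_mul_simple w j
  have h3 := cs.length_mul_simple (cs.simple i * w) j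
  have h4 := cs.length_simple_mul (w * cs.simple j) i
  rw [← mul_assoc] at h4 ⊢
  by_cases he : cs.simple i * w = w * cs.simple j
  · have e1 : cs.simple i * (w * cs.simple j) = w := by
      rw [← he, cs.simple_mul_simple_cancel_left]
    have key : leftCoeff cs i (w * cs.simple j) + rightCoeff cs j w =
        rightCoeff cs j (cs.simple i * w) + leftCoeff cs i w := by
      simp only [leftCoeff, rightCoeff]
      rw [e1, he, cs.simple_mul_simple_cancel_right]
    rw [he] at key ⊢
    have key' := congrArg (fun c : LZ => c • Finsupp.single (w * cs.simple j) (1 : LZ)) key.symm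
    simp only [add_smul] at key'
    simp only [smul_smul, mul_comm (rightCoeff cs j w)]
    rw [← sub_eq_zero] at key' ⊢
    refine Eq.trans ?_ key'
    abel
  · have k1 : leftCoeff cs i (w * cs.simple j) = leftCoeff cs i w ∧
        rightCoeff cs j (cs.simple i * w) = rightCoeff cs j w := by
      have hup : ¬ (cs.length w < cs.length (cs.simple i * w) ∧
          cs.length w < cs.length (w * cs.simple j) ∧
          cs.length (cs.simple i * w * cs.simple j) < cs.length (cs.simple i * w)) :=
        fun ⟨a, b, c⟩ => he (simple_mul_eq_mul_simple cs a b c)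
      have hdown : ¬ (cs.length (cs.simple i * w) < cs.length w ∧
          cs.length (cs.simple i * w) < cs.length (cs.simple i * w * cs.simple j) ∧
          cs.length (w * cs.simple j) < cs.length w) := by
        rintro ⟨a, b, c⟩
        have := simple_mul_eq_mul_simple cs (w := cs.simple i * w) (i := i) (j := j)
          (by rwa [cs.simple_mul_simple_cancel_left]) b
          (by rwa [cs.simple_mul_simple_cancel_left])
        rw [cs.simple_mul_simple_cancel_left] at this
        apply he
        conv_rhs => rw [this, cs.simple_mul_simple_cancel_right]
      simp only [leftCoeff, rightCoeff]
      rw [← mul_assoc]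
      constructor
      · congr 1; rw [eq_iff_iff]; omega
      · congr 1; rw [eq_iff_iff]; omega
    rw [k1.1, k1.2]
    simp only [smul_smul, mul_comm (rightCoeff cs j w)]
    abel

theorem leftOp_sq (i : B) : leftOp cs i * leftOp cs i = 1 + (vInv - v) • leftOp cs i := by
  refine end_ext_single fun w => ?_
  simp only [Module.End.mul_apply, LinearMap.add_apply, LinearMap.smul_apply, Module.End.one_apply]
  rw [leftOp_single, map_add, map_smul, leftOp_single, leftOp_single,
    cs.simple_mul_simple_cancel_left]
  have h1 := cs.length_simple_mul w i
  simp only [leftCoeff, cs.simple_mul_simple_cancel_left]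
  by_cases h : cs.length (cs.simple i * w) < cs.length w
  · have h' : ¬ cs.length w < cs.length (cs.simple i * w) := by omega
    simp only [h, h', if_true, if_false]; module
  · have h' : cs.length w < cs.length (cs.simple i * w) := by omega
    simp only [h, h', if_true, if_false]; module

theorem leftOp_quadratic (i : B) : (leftOp cs i + algebraMap LZ _ v) *
    (leftOp cs i - algebraMap LZ _ vInv) = 0 := by
  refine end_ext_single fun w => ?_
  have h := congrArg (fun T : Module.End LZ (W →₀ LZ) => T (Finsupp.single w 1)) (leftOp_sq cs i)
  simp only [Module.End.mul_apply, LinearMap.add_apply, LinearMap.smul_apply,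
    Module.End.one_apply] at h
  simp only [Module.End.mul_apply, LinearMap.add_apply, LinearMap.sub_apply,
    Module.algebraMap_end_apply, map_sub, map_smul, h, LinearMap.zero_apply]
  match_scalars
  · linear_combination -vInv_mul_v
  · ring

/-- The free module with basis `W` is generated by the unit element under the right operators. -/
theorem single_mem_of_rightOp_mem (S : Submodule LZ (W →₀ LZ)) (h1 : Finsupp.single 1 1 ∈ S)
    (hS : ∀ i, ∀ x ∈ S, rightOp cs i x ∈ S) (w : W) : Finsupp.single w 1 ∈ S := by
  induction w using cs.simple_induction_right with
  | one => exact h1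
  | mul_simple_right w i ih =>
    have h := hS i _ ih
    rw [rightOp_single] at h
    exact (Submodule.add_mem_iff_left S (S.smul_mem _ ih)).1 h

/-- On the unit element, the alternating products of left operators that enter the braid relations
pass through reduced expressions only. -/
theorem altProd_leftOp_single {i j : B} (n : ℕ) (hn : n ≤ M i j) :
    altProd (leftOp cs i) (leftOp cs j) n (Finsupp.single 1 1) =
      Finsupp.single (altProd (cs.simple i) (cs.simple j) n) 1 := by
  induction n generalizing i j with
  | zero => simp [altProd]
  | succ n ih =>
    have hsym := M.symmetric i j
    have h1 := length_altProd cs (n + 1) hn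
    have h2 := length_altProd cs (i := j) (j := i) n (by omega)
    rw [altProd] at h1
    rw [altProd, Module.End.mul_apply, ih (by omega), leftOp_single, altProd, leftCoeff,
      if_neg (by omega), zero_smul, add_zero]

theorem leftOp_braid (i j : B) : altProd (leftOp cs i) (leftOp cs j) (M i j) =
    altProd (leftOp cs j) (leftOp cs i) (M i j) := by
  -- Both sides commute with the right operators and agree at the unit element.
  refine end_ext_single fun w => ?_
  refine single_mem_of_rightOp_mem cs (LinearMap.eqLocus _ _) ?_ ?_ w
  · change _ = _
    rw [altProd_leftOp_single cs _ le_rfl,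
      altProd_leftOp_single cs _ (M.symmetric i j).le, altProd_simple_comm]
  · intro k x hx
    have c := fun a b => altProd_commute (M i j) (rightOp_commute_leftOp cs a k)
      (rightOp_commute_leftOp cs b k)
    have c1 := congrArg (fun T : Module.End LZ (W →₀ LZ) => T x) (c i j).eq
    have c2 := congrArg (fun T : Module.End LZ (W →₀ LZ) => T x) (c j i).eq
    simp only [Module.End.mul_apply] at c1 c2
    change _ = _ at hx ⊢
    rw [← c1, ← c2, hx]

/-- The left regular representation of the Hecke algebra on the free module with basis `W`. -/
def regRep : HeckeAlgebra M →+* Module.End LZ (W →₀ LZ) :=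
  heckeLift M (algebraMap LZ _) (fun r a => Algebra.commutes r a) (leftOp cs)
    (leftOp_quadratic cs) (leftOp_braid cs)

theorem regRep_gen (i : B) : regRep cs (gen M i) = leftOp cs i := heckeLift_gen ..

theorem regRep_smul (r : LZ) (h : HeckeAlgebra M) : regRep cs (r • h) = r • regRep cs h := by
  rw [Algebra.smul_def, map_mul, regRep, heckeLift_algebraMap, ← Algebra.smul_def]

/-- The coordinates of an element of the Hecke algebra in the standard basis. -/
def heckeCoords : HeckeAlgebra M →ₗ[LZ] W →₀ LZ where
  toFun h := regRep cs h (Finsupp.single 1 1)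
  map_add' x y := by rw [map_add]; rfl
  map_smul' r x := by rw [regRep_smul]; rfl

theorem heckeCoords_gen_mul (i : B) (h : HeckeAlgebra M) :
    heckeCoords cs (gen M i * h) = leftOp cs i (heckeCoords cs h) := by
  change regRep cs (gen M i * h) _ = _
  rw [map_mul, regRep_gen]; rfl

theorem heckeCoords_stdHecke (w : W) : heckeCoords cs (stdHecke cs w) = Finsupp.single w 1 := by
  obtain ⟨n, hn⟩ : ∃ n, cs.length w = n := ⟨_, rfl⟩
  induction n generalizing w with
  | zero =>
    rw [cs.length_eq_zero_iff] at hn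
    rw [hn, stdHecke_one]
    change regRep cs 1 _ = _
    rw [map_one]; rfl
  | succ n ih =>
    have hw : w ≠ 1 := by rintro rfl; simp at hn
    obtain ⟨i, hi⟩ := cs.exists_leftDescent_of_ne_one hw
    rw [cs.isLeftDescent_iff] at hi
    have h := gen_mul_stdHecke cs (i := i) (w := cs.simple i * w)
      (by rw [cs.simple_mul_simple_cancel_left, hi])
    rw [cs.simple_mul_simple_cancel_left] at h
    rw [← h, heckeCoords_gen_mul, ih _ (by omega), leftOp_single, cs.simple_mul_simple_cancel_left,
      leftCoeff, if_neg (by rw [cs.simple_mul_simple_cancel_left]; omega), zero_smul, add_zero]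

theorem heckeCoords_injective : Function.Injective (heckeCoords cs) := by
  have key : ∀ h, Finsupp.linearCombination LZ (stdHecke cs) (heckeCoords cs h) = h := by
    intro h
    have hh : h ∈ Submodule.span LZ (Set.range (stdHecke cs)) := by
      rw [span_stdHecke]; trivial
    induction hh using Submodule.span_induction with
    | mem x hx => obtain ⟨w, rfl⟩ := hx; rw [heckeCoords_stdHecke]; simp
    | zero => simp
    | add x y _ _ hx hy => rw [map_add, map_add, hx, hy]
    | smul r x _ hx => rw [map_smul, map_smul, hx]
  intro a b hab
  rw [← key a, hab, key b]

/-- The bar involution is unitriangular: `H̄_w` is `H_w` plus a combination of the `H_y`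
with `y < w`. -/
theorem bar_stdHecke_sub_mem (w : W) : bar M (stdHecke cs w) - stdHecke cs w ∈
    Submodule.span LZ (stdHecke cs '' {y | BruhatLT cs y w}) := by
  obtain ⟨n, hn⟩ : ∃ n, cs.length w = n := ⟨_, rfl⟩
  induction n generalizing w with
  | zero =>
    rw [cs.length_eq_zero_iff] at hn
    rw [hn, stdHecke_one, map_one, sub_self]
    exact zero_mem _
  | succ n ih =>
    have hw : w ≠ 1 := by rintro rfl; simp at hn
    obtain ⟨i, hi⟩ := cs.exists_rightDescent_of_ne_one hw
    rw [cs.isRightDescent_iff] at hi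
    obtain ⟨u, rfl⟩ : ∃ u, w = u * cs.simple i := ⟨w * cs.simple i, by simp⟩
    rw [cs.simple_mul_simple_cancel_right] at hi
    have hlt : cs.length u < cs.length (u * cs.simple i) := by omega
    have hu := bruhatLT_mul_simple cs hlt
    have ih' := ih u (by omega)
    rw [← stdHecke_mul_gen cs hi.symm, map_mul, bar_gen]
    have e : bar M (stdHecke cs u) * (gen M i + algebraMap LZ _ (v - vInv)) -
        stdHecke cs u * gen M i = (bar M (stdHecke cs u) - stdHecke cs u) * gen M i +
          (v - vInv) • (bar M (stdHecke cs u) - stdHecke cs u) + (v - vInv) • stdHecke cs u := by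
      rw [mul_add, ← Algebra.commutes, ← Algebra.smul_def, sub_mul, smul_sub]; abel
    rw [e]
    have hmono : Submodule.span LZ (stdHecke cs '' {y | BruhatLT cs y u}) ≤
        Submodule.span LZ (stdHecke cs '' {y | BruhatLT cs y (u * cs.simple i)}) :=
      Submodule.span_mono (Set.image_mono fun y hy => hy.trans cs hu)
    refine add_mem (add_mem ?_ (Submodule.smul_mem _ _ (hmono ih')))
      (Submodule.smul_mem _ _ (Submodule.subset_span ⟨u, hu, rfl⟩))
    generalize bar M (stdHecke cs u) - stdHecke cs u = x at ih'
    induction ih' using Submodule.span_induction with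
    | mem x hx =>
      obtain ⟨y, hy, rfl⟩ := hx
      have hy1 : stdHecke cs (y * cs.simple i) ∈
          Submodule.span LZ (stdHecke cs '' {y | BruhatLT cs y (u * cs.simple i)}) :=
        Submodule.subset_span ⟨_, bruhat_mul_simple_of_lt cs hy hlt, rfl⟩
      rcases cs.length_mul_simple y i with h | h
      · rwa [stdHecke_mul_gen cs h]
      · rw [stdHecke_mul_gen' cs h]
        exact add_mem hy1 (Submodule.smul_mem _ _ (Submodule.subset_span ⟨y, hy.trans cs hu, rfl⟩))
    | zero => rw [zero_mul]; exact zero_mem _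
    | add x y _ _ hx hy => rw [add_mul]; exact add_mem hx hy
    | smul r x _ hx => rw [smul_mul_assoc]; exact Submodule.smul_mem _ _ hx

end HeckeBasis

/-! ### Laurent polynomials -/

section Laurent

/-- The subring `ℤ[v]` of `ℤ[v, v⁻¹]`. -/
def Zv : Subring LZ := (Polynomial.toLaurent : Polynomial ℤ →+* LZ).range

theorem v_mem_Zv : v ∈ Zv := ⟨Polynomial.X, Polynomial.toLaurent_X⟩

theorem T_mem_Zv {n : ℤ} (hn : 0 ≤ n) : (LaurentPolynomial.T n : LZ) ∈ Zv := by
  obtain ⟨k, rfl⟩ := Int.eq_ofNat_of_zero_le hn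
  exact ⟨Polynomial.X ^ k, Polynomial.toLaurent_X_pow k⟩

theorem mem_vZv_iff {f : LZ} : f ∈ vZv ↔ ∃ g ∈ Zv, f = v * g := by
  constructor
  · rintro ⟨p, rfl⟩; exact ⟨_, ⟨p, rfl⟩, rfl⟩
  · rintro ⟨_, ⟨p, rfl⟩, rfl⟩; exact ⟨p, rfl⟩

theorem mem_Zv_of_mem_vZv {f : LZ} (hf : f ∈ vZv) : f ∈ Zv := by
  obtain ⟨g, hg, rfl⟩ := mem_vZv_iff.1 hf
  exact mul_mem v_mem_Zv hg

theorem v_mul_mem_vZv {f : LZ} (hf : f ∈ Zv) : v * f ∈ vZv := mem_vZv_iff.2 ⟨f, hf, rfl⟩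

theorem zero_mem_vZv : (0 : LZ) ∈ vZv := mem_vZv_iff.2 ⟨0, zero_mem _, by simp⟩

theorem add_mem_vZv {f g : LZ} (hf : f ∈ vZv) (hg : g ∈ vZv) : f + g ∈ vZv := by
  obtain ⟨a, ha, rfl⟩ := mem_vZv_iff.1 hf
  obtain ⟨b, hb, rfl⟩ := mem_vZv_iff.1 hg
  rw [← mul_add]; exact v_mul_mem_vZv (add_mem ha hb)

theorem mul_mem_vZv {f g : LZ} (hf : f ∈ vZv) (hg : g ∈ Zv) : f * g ∈ vZv := by
  obtain ⟨a, ha, rfl⟩ := mem_vZv_iff.1 hf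
  rw [mul_assoc]; exact v_mul_mem_vZv (mul_mem ha hg)

theorem sub_mem_vZv {f g : LZ} (hf : f ∈ vZv) (hg : g ∈ vZv) : f - g ∈ vZv := by
  rw [sub_eq_add_neg, ← mul_neg_one g]
  exact add_mem_vZv hf (mul_mem_vZv hg (neg_mem (one_mem _)))

theorem sum_mem_vZv {ι : Type*} {s : Finset ι} {f : ι → LZ} (h : ∀ i ∈ s, f i ∈ vZv) :
    ∑ i ∈ s, f i ∈ vZv :=
  Finset.sum_induction f (· ∈ vZv) (fun _ _ => add_mem_vZv) zero_mem_vZv h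

theorem T_mem_vZv {n : ℤ} (hn : 0 < n) : (LaurentPolynomial.T n : LZ) ∈ vZv := by
  rw [show n = 1 + (n - 1) by ring, LaurentPolynomial.T_add]
  exact v_mul_mem_vZv (T_mem_Zv (by omega))

theorem coeff_C_mul_T (a n m : ℤ) :
    (LaurentPolynomial.C a * LaurentPolynomial.T n : LZ).coeff m = if n = m then a else 0 := by
  rw [← LaurentPolynomial.single_eq_C_mul_T]
  exact Finsupp.single_apply

theorem coeff_eq_zero_of_mem_vZv {f : LZ} (hf : f ∈ vZv) {n : ℤ} (hn : n ≤ 0) :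
    f.coeff n = 0 := by
  obtain ⟨p, rfl⟩ := hf
  induction p using Polynomial.induction_on' with
  | add p q hp hq => rw [map_add, mul_add, AddMonoidAlgebra.coeff_add, Finsupp.add_apply, hp, hq,
      add_zero]
  | monomial k a =>
    rw [← Polynomial.C_mul_X_pow_eq_monomial, Polynomial.toLaurent_C_mul_X_pow, mul_left_comm,
      ← LaurentPolynomial.T_add, coeff_C_mul_T, if_neg (by omega)]

theorem barLZ_coeff (f : LZ) (n : ℤ) : (barLZ f).coeff n = f.coeff (-n) :=
  LaurentPolynomial.invert_apply f n

/-- A bar-invariant element of `v ℤ[v]` vanishes. -/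
theorem eq_zero_of_barLZ_eq {f : LZ} (hf : f ∈ vZv) (hb : barLZ f = f) : f = 0 := by
  refine LaurentPolynomial.ext fun n => ?_
  rcases le_total n 0 with hn | hn
  · rw [coeff_eq_zero_of_mem_vZv hf hn]; simp
  · rw [← hb, barLZ_coeff, coeff_eq_zero_of_mem_vZv hf (by omega)]; simp

/-- The part of a Laurent polynomial in positive degrees. -/
def posPart (f : LZ) : LZ :=
  v * Polynomial.toLaurent (LaurentPolynomial.trunc (vInv * f))

theorem posPart_mem_vZv (f : LZ) : posPart f ∈ vZv := ⟨_, rfl⟩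

theorem posPart_zero : posPart 0 = 0 := by simp [posPart]

theorem posPart_coeff (f : LZ) (n : ℤ) : (posPart f).coeff n = if 0 < n then f.coeff n else 0 := by
  induction f using LaurentPolynomial.induction_on' with
  | add p q hp hq =>
    have : posPart (p + q) = posPart p + posPart q := by simp [posPart, mul_add]
    rw [this, AddMonoidAlgebra.coeff_add, AddMonoidAlgebra.coeff_add, Finsupp.add_apply,
      Finsupp.add_apply, hp, hq]
    split_ifs <;> simp
  | C_mul_T k a =>
    rw [posPart, mul_left_comm vInv, ← LaurentPolynomial.T_add, LaurentPolynomial.trunc_C_mul_T,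
      coeff_C_mul_T]
    by_cases hk : 0 ≤ -1 + k
    · rw [if_pos hk, ← Polynomial.C_mul_X_pow_eq_monomial, Polynomial.toLaurent_C_mul_X_pow,
        mul_left_comm, ← LaurentPolynomial.T_add, coeff_C_mul_T, Int.toNat_of_nonneg hk,
        add_neg_cancel_left]
      split_ifs <;> first | rfl | omega
    · rw [if_neg hk, map_zero, mul_zero]
      split_ifs <;> first | rfl | omega

/-- A Laurent polynomial `f` with `f̄ = -f` is the difference of its positive part and the conjugate
of that part. -/
theorem eq_posPart_sub {f : LZ} (hf : barLZ f = -f) : f = posPart f - barLZ (posPart f) := by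
  have h : ∀ n, f.coeff (-n) = - f.coeff n := by
    intro n
    rw [← barLZ_coeff, hf, AddMonoidAlgebra.coeff_neg, Finsupp.neg_apply]
  refine LaurentPolynomial.ext fun n => ?_
  rw [AddMonoidAlgebra.coeff_sub, Finsupp.sub_apply, barLZ_coeff, posPart_coeff, posPart_coeff, h]
  rcases lt_trichotomy n 0 with hn | rfl | hn
  · rw [if_neg (by omega), if_pos (by omega)]; ring
  · have := h 0; simp at this ⊢; omega
  · rw [if_pos hn, if_neg (by omega)]; ring

theorem v_add_vInv_ne_zero : v + vInv ≠ 0 := by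
  intro h
  have h1 := congrArg (fun f : LZ => f.coeff 1) h
  simp only [AddMonoidAlgebra.coeff_add, Finsupp.add_apply, LaurentPolynomial.T_apply] at h1
  norm_num at h1

end Laurent

/-! ### Induced modules -/

section IndModule

variable {B : Type*} {M : CoxeterMatrix B} (I : Set B) (ε : OneDim)

variable (M) in
/-- The quotient map `x ↦ 1 ⊗ x` from the Hecke algebra to the induced module. -/
def indMk : HeckeAlgebra M →ₗ[LZ] IndModule M I ε :=
  (balanced M I ε).mkQ ∘ₗ TensorProduct.mk LZ LZ (HeckeAlgebra M) 1

theorem indMk_surjective : Function.Surjective (indMk M I ε) := by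
  intro m
  obtain ⟨t, rfl⟩ := Submodule.mkQ_surjective _ m
  induction t using TensorProduct.induction_on with
  | zero => exact ⟨0, by simp⟩
  | tmul a x =>
    refine ⟨a • x, ?_⟩
    rw [indMk, LinearMap.comp_apply, TensorProduct.mk_apply, TensorProduct.tmul_smul,
      TensorProduct.smul_tmul', smul_eq_mul, mul_one]
  | add x y hx hy =>
    obtain ⟨a, ha⟩ := hx
    obtain ⟨b, hb⟩ := hy
    exact ⟨a + b, by rw [map_add, map_add, ha, hb]⟩

theorem char_gen (i : I) : ε.char (restrict M I) (gen _ i) = ε.scalar := heckeLift_gen ..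

theorem char_algebraMap (r : LZ) : ε.char (restrict M I) (algebraMap LZ _ r) = r :=
  heckeLift_algebraMap ..

theorem incl_gen (i : I) : incl M I (gen _ i) = gen M i := heckeLift_gen ..

theorem incl_algebraMap (r : LZ) : incl M I (algebraMap LZ _ r) = algebraMap LZ _ r :=
  heckeLift_algebraMap ..

variable {I ε}

theorem indMk_gen_mul {i : B} (hi : i ∈ I) (x : HeckeAlgebra M) :
    indMk M I ε (gen M i * x) = ε.scalar • indMk M I ε x := by
  symm
  rw [← map_smul, ← sub_eq_zero, ← map_sub]
  change (balanced M I ε).mkQ _ = 0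
  rw [Submodule.mkQ_apply, Submodule.Quotient.mk_eq_zero]
  refine Submodule.subset_span ⟨1, gen _ (⟨i, hi⟩ : I), x, ?_⟩
  rw [char_gen, incl_gen, one_mul, map_sub, TensorProduct.mk_apply, TensorProduct.mk_apply,
    TensorProduct.tmul_smul, TensorProduct.smul_tmul', smul_eq_mul, mul_one]

theorem barInd_indMk (x : HeckeAlgebra M) :
    barInd M I ε (indMk M I ε x) = indMk M I ε (bar M x) := by
  change (balanced M I ε).mkQ (barTensor M (1 ⊗ₜ x)) = (balanced M I ε).mkQ (1 ⊗ₜ bar M x)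
  have h : barTensor M ((1 : LZ) ⊗ₜ[LZ] x) = barLZ 1 ⊗ₜ[LZ] bar M x := rfl
  rw [h, map_one]

theorem map_incl_mul {N : Type*} [AddCommGroup N] [Module LZ N] (g : HeckeAlgebra M →ₗ[LZ] N)
    (hg : ∀ i ∈ I, ∀ x, g (gen M i * x) = ε.scalar • g x) (h : HeckeAlgebra (restrict M I)) :
    ∀ x, g (incl M I h * x) = ε.char (restrict M I) h • g x := by
  obtain ⟨a, rfl⟩ := mk_surjective _ h
  induction a using FreeAlgebra.induction with
  | grade0 r =>
    intro x
    rw [AlgHom.commutes, incl_algebraMap, char_algebraMap, ← Algebra.smul_def, map_smul]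
  | grade1 s =>
    intro x
    have h := hg s s.2 x
    rw [← incl_gen, ← char_gen I ε s] at h
    exact h
  | mul a b ha hb =>
    intro x
    rw [map_mul (mk _), map_mul (incl M I), map_mul (ε.char _), mul_assoc, ha, hb, smul_smul]
  | add a b ha hb =>
    intro x
    rw [map_add (mk _), map_add (incl M I), map_add (ε.char _), add_mul, map_add, ha, hb, add_smul]

/-- The linear map out of the induced module defined by a linear map on the Hecke algebra that is
compatible with left multiplication by the `H_s` for `s ∈ I`. -/
def indLift {N : Type*} [AddCommGroup N] [Module LZ N] (g : HeckeAlgebra M →ₗ[LZ] N)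
    (hg : ∀ i ∈ I, ∀ x, g (gen M i * x) = ε.scalar • g x) : IndModule M I ε →ₗ[LZ] N :=
  (balanced M I ε).liftQ (g ∘ₗ (TensorProduct.lid LZ (HeckeAlgebra M)).toLinearMap) <| by
    refine Submodule.span_le.2 ?_
    rintro _ ⟨a, h, x, rfl⟩
    change (g ∘ₗ _) _ = 0
    rw [map_sub, sub_eq_zero]
    change g (TensorProduct.lid LZ _ _) = g (TensorProduct.lid LZ _ _)
    rw [TensorProduct.lid_tmul, TensorProduct.lid_tmul, map_smul, map_smul,
      map_incl_mul g hg, smul_smul]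

theorem indLift_indMk {N : Type*} [AddCommGroup N] [Module LZ N] (g : HeckeAlgebra M →ₗ[LZ] N)
    (hg : ∀ i ∈ I, ∀ x, g (gen M i * x) = ε.scalar • g x) (x : HeckeAlgebra M) :
    indLift g hg (indMk M I ε x) = g x := by
  change g (TensorProduct.lid LZ _ _) = _
  rw [TensorProduct.mk_apply, TensorProduct.lid_tmul, one_smul]

end IndModule

/-! ### The standard basis of an induced module -/

section StdBasis

variable {B : Type*} {M : CoxeterMatrix B} {W : Type*} [Group W] (cs : CoxeterSystem M W)
  (I : Set B) (ε : OneDim)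

theorem stdInd_eq (x : minLeft cs I) : stdInd cs I ε x = indMk M I ε (stdHecke cs (x : W)) := rfl

variable {I} in
theorem indMk_stdHecke_mul {u : W} (hu : u ∈ parabolic cs I) (x : minLeft cs I) :
    indMk M I ε (stdHecke cs (u * x)) = ε.scalar ^ cs.length u • stdInd cs I ε x := by
  refine parabolic_induction cs (p := fun u => indMk M I ε (stdHecke cs (u * x)) =
    ε.scalar ^ cs.length u • stdInd cs I ε x) (by simp [stdInd_eq]) ?_ hu
  intro i hi u hu hl ih
  have h1 := length_mul_of_mem_minLeft cs x.2 hu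
  have h2 := length_mul_of_mem_minLeft cs x.2 (mul_mem (simple_mem_parabolic cs hi) hu)
  rw [mul_assoc] at h2 ⊢
  rw [← gen_mul_stdHecke cs (by omega), indMk_gen_mul hi, ih, smul_smul, hl, pow_succ']

theorem indMk_stdHecke (w : W) : indMk M I ε (stdHecke cs w) =
    ε.scalar ^ (cs.length w - cs.length (minRep cs I w : W)) • stdInd cs I ε (minRep cs I w) := by
  obtain ⟨u, hu, e⟩ := exists_mul_minRep cs I w
  have hl := length_mul_of_mem_minLeft cs (minRep cs I w).2 hu
  rw [← e] at hl
  conv_lhs => rw [e, indMk_stdHecke_mul cs ε hu]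
  rw [hl, Nat.add_sub_cancel]

/-- The projection from the free module with basis `W` onto the free module with basis `ᴵW` that
sends the element `u x` with `u ∈ W_I` and `x ∈ ᴵW` to the multiple of `x` by the `ℓ(u)`-th power
of the scalar of `ε`. -/
def cosetProj : (W →₀ LZ) →ₗ[LZ] minLeft cs I →₀ LZ :=
  Finsupp.linearCombination LZ fun w =>
    ε.scalar ^ (cs.length w - cs.length (minRep cs I w : W)) • Finsupp.single (minRep cs I w) 1

theorem cosetProj_single (w : W) : cosetProj cs I ε (Finsupp.single w 1) =
    ε.scalar ^ (cs.length w - cs.length (minRep cs I w : W)) •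
      Finsupp.single (minRep cs I w) 1 := by
  simp [cosetProj]

theorem scalar_mul_scalar : ε.scalar * ε.scalar = 1 + (vInv - v) * ε.scalar := by
  have h := ε.scalar_quadratic
  linear_combination h + v_mul_vInv

variable {I} in
theorem cosetProj_leftOp {i : B} (hi : i ∈ I) (e : W →₀ LZ) :
    cosetProj cs I ε (leftOp cs i e) = ε.scalar • cosetProj cs I ε e := by
  have key : cosetProj cs I ε ∘ₗ leftOp cs i = ε.scalar • cosetProj cs I ε := by
    refine Finsupp.lhom_ext' fun w => LinearMap.ext_ring ?_
    change cosetProj cs I ε (leftOp cs i (Finsupp.single w 1)) =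
      ε.scalar • cosetProj cs I ε (Finsupp.single w 1)
    have hr := minRep_mul cs (simple_mem_parabolic cs hi) w
    have h1 := length_minRep_le cs (I := I) w
    have h2 := length_minRep_le cs (I := I) (cs.simple i * w)
    rw [leftOp_single, map_add, map_smul, cosetProj_single, cosetProj_single, leftCoeff, hr]
    rw [hr] at h2
    rcases cs.length_simple_mul w i with h | h
    · rw [if_neg (by omega), h, Nat.sub_add_comm h1, pow_succ', zero_smul, add_zero, smul_smul]
    · rw [if_pos (by omega), ← h, Nat.sub_add_comm h2, pow_succ', smul_smul, smul_smul, ← add_smul]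
      congr 1
      linear_combination -(ε.scalar ^ (cs.length (cs.simple i * w) -
        cs.length (minRep cs I w : W))) * scalar_mul_scalar ε
  exact LinearMap.congr_fun key e

/-- The coordinates of an element of the induced module in the standard basis. -/
def stdCoords : IndModule M I ε →ₗ[LZ] minLeft cs I →₀ LZ :=
  indLift (cosetProj cs I ε ∘ₗ heckeCoords cs) fun i hi x => by
    rw [LinearMap.comp_apply, heckeCoords_gen_mul, cosetProj_leftOp cs ε hi, LinearMap.comp_apply]

theorem stdCoords_stdInd (x : minLeft cs I) :
    stdCoords cs I ε (stdInd cs I ε x) = Finsupp.single x 1 := by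
  rw [stdInd_eq, stdCoords, indLift_indMk, LinearMap.comp_apply, heckeCoords_stdHecke,
    cosetProj_single, minRep_of_mem cs x.2]
  simp

theorem linearIndependent_stdInd : LinearIndependent LZ (stdInd cs I ε) := by
  refine LinearIndependent.of_comp (stdCoords cs I ε) ?_
  have : stdCoords cs I ε ∘ stdInd cs I ε = fun x => Finsupp.single x 1 :=
    funext (stdCoords_stdInd cs I ε)
  rw [this]
  exact (Finsupp.basisSingleOne (R := LZ)).linearIndependent

theorem span_stdInd : Submodule.span LZ (Set.range (stdInd cs I ε)) = ⊤ := by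
  rw [eq_top_iff]
  intro m _
  obtain ⟨h, rfl⟩ := indMk_surjective I ε m
  have hh : h ∈ Submodule.span LZ (Set.range (stdHecke cs)) := by rw [span_stdHecke]; trivial
  induction hh using Submodule.span_induction with
  | mem x hx =>
    obtain ⟨w, rfl⟩ := hx
    rw [indMk_stdHecke]
    exact Submodule.smul_mem _ _ (Submodule.subset_span ⟨_, rfl⟩)
  | zero => rw [map_zero]; exact zero_mem _
  | add x y _ _ hx hy => rw [map_add]; exact add_mem (hx trivial) (hy trivial)
  | smul r x _ hx => rw [map_smul]; exact Submodule.smul_mem _ _ (hx trivial)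

/-- The standard basis of the induced module. -/
def stdBasis : Module.Basis (minLeft cs I) LZ (IndModule M I ε) :=
  Module.Basis.mk (linearIndependent_stdInd cs I ε) (span_stdInd cs I ε).ge

theorem stdBasis_apply (x : minLeft cs I) : stdBasis cs I ε x = stdInd cs I ε x :=
  Module.Basis.mk_apply _ _ x

theorem coe_stdBasis : ⇑(stdBasis cs I ε) = stdInd cs I ε := funext (stdBasis_apply cs I ε)

theorem repr_stdInd (x : minLeft cs I) :
    (stdBasis cs I ε).repr (stdInd cs I ε x) = Finsupp.single x 1 := by
  rw [← stdBasis_apply, Module.Basis.repr_self]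

/-- The bar involution of the induced module is unitriangular in the standard basis. -/
theorem barInd_stdInd_sub_mem (x : minLeft cs I) :
    barInd M I ε (stdInd cs I ε x) - stdInd cs I ε x ∈
      Submodule.span LZ (stdInd cs I ε '' {y | BruhatLT cs (y : W) (x : W)}) := by
  rw [stdInd_eq, barInd_indMk, ← map_sub]
  have h := bar_stdHecke_sub_mem cs (x : W)
  generalize bar M (stdHecke cs (x : W)) - stdHecke cs (x : W) = a at h
  induction h using Submodule.span_induction with
  | mem a ha =>
    obtain ⟨y, hy, rfl⟩ := ha
    rw [indMk_stdHecke]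
    refine Submodule.smul_mem _ _ (Submodule.subset_span ⟨_, ?_, rfl⟩)
    rcases minRep_eq_or_bruhatLT cs (I := I) y with h | h
    · exact (congrArg (fun z => BruhatLT cs z (x : W)) h).mpr hy
    · exact h.trans cs hy
  | zero => rw [map_zero]; exact zero_mem _
  | add a b _ _ ha hb => rw [map_add]; exact add_mem ha hb
  | smul r a _ ha => rw [map_smul]; exact Submodule.smul_mem _ _ ha

end StdBasis

/-! ### The Kazhdan–Lusztig basis of an induced module -/

section KLBasis

variable {B : Type*} {M : CoxeterMatrix B} {W : Type*} [Group W] (cs : CoxeterSystem M W)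
  {I : Set B} {ε : OneDim}

/-- In a combination of vectors for which, within the support, the coefficient of a fixed basis
vector is unitriangular, that coefficient can be read off. -/
theorem repr_linearCombination_of_unitriangular {ι N : Type*} [DecidableEq ι] [AddCommGroup N]
    [Module LZ N] (b : Module.Basis ι LZ N) (K : ι → N) (g : ι →₀ LZ) (x : ι)
    (h : ∀ y, g y ≠ 0 → b.repr (K y) x = if y = x then 1 else 0) :
    b.repr (Finsupp.linearCombination LZ K g) x = g x := by
  rw [Finsupp.linearCombination_apply, Finsupp.sum, map_sum, Finsupp.finsetSum_apply]
  rw [Finset.sum_congr rfl (g := fun y => if y = x then g x else 0)]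
  · rw [Finset.sum_ite_eq']
    split_ifs with hx
    · rfl
    · exact (Finsupp.notMem_support_iff.1 hx).symm
  · intro y hy
    rw [map_smul, Finsupp.smul_apply, h y (Finsupp.mem_support_iff.1 hy)]
    split_ifs with hyx
    · rw [hyx, smul_eq_mul, mul_one]
    · rw [smul_zero]

theorem exists_maximal_length {g : minLeft cs I →₀ LZ} (hg : g ≠ 0) :
    ∃ x, g x ≠ 0 ∧ ∀ y, g y ≠ 0 → cs.length (y : W) ≤ cs.length (x : W) := by
  obtain ⟨x, hx, h⟩ := Finset.exists_max_image g.support (fun y => cs.length (y : W))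
    (Finsupp.support_nonempty_iff.2 hg)
  exact ⟨x, Finsupp.mem_support_iff.1 hx, fun y hy => h y (Finsupp.mem_support_iff.2 hy)⟩

theorem barInd_eq_linearCombination (m : IndModule M I ε) : barInd M I ε m =
    Finsupp.linearCombination LZ (fun y => barInd M I ε (stdInd cs I ε y))
      (((stdBasis cs I ε).repr m).mapRange barLZ (map_zero _)) := by
  conv_lhs => rw [← (stdBasis cs I ε).linearCombination_repr m]
  rw [Finsupp.linearCombination_apply, Finsupp.linearCombination_apply,
    Finsupp.sum_mapRange_index (by simp), Finsupp.sum, map_sum]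
  refine Finset.sum_congr rfl fun y _ => ?_
  rw [LinearMap.map_smulₛₗ, stdBasis_apply]

open Classical in
theorem repr_barInd_stdInd {x y : minLeft cs I} (h : cs.length (y : W) ≤ cs.length (x : W)) :
    (stdBasis cs I ε).repr (barInd M I ε (stdInd cs I ε y)) x = if y = x then 1 else 0 := by
  have h1 := barInd_stdInd_sub_mem cs I ε y
  rw [← coe_stdBasis, Module.Basis.mem_span_image, coe_stdBasis] at h1
  have h2 : (stdBasis cs I ε).repr (barInd M I ε (stdInd cs I ε y) - stdInd cs I ε y) x = 0 := by
    by_contra hne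
    have h3 : BruhatLT cs (x : W) (y : W) := h1 (Finsupp.mem_support_iff.2 hne)
    have := h3.length_lt
    omega
  rw [map_sub, Finsupp.sub_apply, sub_eq_zero, repr_stdInd, Finsupp.single_apply] at h2
  exact h2

/-- A bar-invariant element with all coefficients in `v ℤ[v]` vanishes. -/
theorem eq_zero_of_barInd_eq {m : IndModule M I ε} (hb : barInd M I ε m = m)
    (hm : ∀ y, (stdBasis cs I ε).repr m y ∈ vZv) : m = 0 := by
  classical
  by_contra hne
  obtain ⟨x, hx, hmax⟩ := exists_maximal_length cs
    (fun h => hne ((stdBasis cs I ε).repr.map_eq_zero_iff.1 h))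
  have h1 := barInd_eq_linearCombination cs m
  have h2 := repr_linearCombination_of_unitriangular (stdBasis cs I ε)
    (fun y => barInd M I ε (stdInd cs I ε y))
    (((stdBasis cs I ε).repr m).mapRange barLZ (map_zero _)) x ?_
  · rw [← h1, hb, Finsupp.mapRange_apply] at h2
    exact hx (eq_zero_of_barLZ_eq (hm x) h2.symm)
  · intro y hy
    refine repr_barInd_stdInd cs (hmax y ?_)
    rintro h0
    rw [Finsupp.mapRange_apply, h0, map_zero] at hy
    exact hy rfl

open Classical in
theorem IsKL.exists_repr {x : minLeft cs I} {C : IndModule M I ε} (h : IsKL cs I ε x C) :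
    ∃ f : minLeft cs I →₀ LZ, (∀ y, f y ∈ vZv) ∧
      (∀ y, f y ≠ 0 → BruhatLT cs (y : W) (x : W)) ∧
      ∀ y, (stdBasis cs I ε).repr C y = (if x = y then 1 else 0) + f y := by
  obtain ⟨-, f, hf1, hf2, rfl⟩ := h
  refine ⟨f, hf1, hf2, fun y => ?_⟩
  rw [map_add, Finsupp.add_apply, repr_stdInd, Finsupp.single_apply, ← coe_stdBasis,
    Module.Basis.repr_linearCombination]

theorem IsKL.repr_mem_Zv {x : minLeft cs I} {C : IndModule M I ε} (h : IsKL cs I ε x C)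
    (y : minLeft cs I) : (stdBasis cs I ε).repr C y ∈ Zv := by
  classical
  obtain ⟨f, hf1, -, hf3⟩ := h.exists_repr
  rw [hf3]
  refine add_mem ?_ (mem_Zv_of_mem_vZv (hf1 y))
  split_ifs
  exacts [one_mem _, zero_mem _]

theorem IsKL.eq_or_bruhatLT {x : minLeft cs I} {C : IndModule M I ε} (h : IsKL cs I ε x C)
    {y : minLeft cs I} (hy : (stdBasis cs I ε).repr C y ≠ 0) :
    y = x ∨ BruhatLT cs (y : W) (x : W) := by
  classical
  obtain ⟨f, -, hf2, hf3⟩ := h.exists_repr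
  rw [hf3] at hy
  by_cases hxy : x = y
  · exact .inl hxy.symm
  · rw [if_neg hxy, zero_add] at hy
    exact .inr (hf2 y hy)

open Classical in
theorem IsKL.repr_of_length_le {x y : minLeft cs I} {C : IndModule M I ε} (h : IsKL cs I ε x C)
    (hl : cs.length (x : W) ≤ cs.length (y : W)) :
    (stdBasis cs I ε).repr C y = if x = y then 1 else 0 := by
  obtain ⟨f, -, hf2, hf3⟩ := h.exists_repr
  rw [hf3]
  have : f y = 0 := by
    by_contra hne
    have := (hf2 y hne).length_lt
    omega
  rw [this, add_zero]

/-- Elements satisfying the characterization of the Kazhdan–Lusztig basis are linearly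
independent. -/
theorem eq_zero_of_linearCombination_isKL {K : minLeft cs I → IndModule M I ε}
    {g : minLeft cs I →₀ LZ} (hK : ∀ y, g y ≠ 0 → IsKL cs I ε y (K y))
    (h : Finsupp.linearCombination LZ K g = 0) : g = 0 := by
  classical
  by_contra hne
  obtain ⟨x, hx, hmax⟩ := exists_maximal_length cs hne
  have h2 := repr_linearCombination_of_unitriangular (stdBasis cs I ε) K g x
    fun y hy => (hK y hy).repr_of_length_le cs (hmax y hy)
  rw [h, map_zero, Finsupp.zero_apply] at h2
  exact hx h2.symm

/-- By inversion of a unitriangular system, the standard basis elements are combinations of the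
Kazhdan–Lusztig basis elements below them. The bound `n` allows for the use of this statement in the
construction of the Kazhdan–Lusztig basis by induction on the length. -/
theorem stdInd_mem_span_of_isKL {K : minLeft cs I → IndModule M I ε} {n : ℕ}
    (hK : ∀ y : minLeft cs I, cs.length (y : W) < n → IsKL cs I ε y (K y))
    {S : Set (minLeft cs I)}
    (hS : ∀ y ∈ S, ∀ z : minLeft cs I, BruhatLT cs (z : W) (y : W) → z ∈ S)
    (y : minLeft cs I) (hy : y ∈ S) (hn : cs.length (y : W) < n) :
    stdInd cs I ε y ∈ Submodule.span LZ (K '' S) := by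
  obtain ⟨k, hk⟩ : ∃ k, cs.length (y : W) = k := ⟨_, rfl⟩
  induction k using Nat.strong_induction_on generalizing y with
  | _ k ih =>
    obtain ⟨-, f, -, hf2, e⟩ := hK y hn
    have e' : stdInd cs I ε y = K y - Finsupp.linearCombination LZ (stdInd cs I ε) f := by
      rw [e, add_sub_cancel_right]
    rw [e']
    refine sub_mem (Submodule.subset_span ⟨y, hy, rfl⟩) ?_
    rw [Finsupp.linearCombination_apply, Finsupp.sum]
    refine Submodule.sum_mem _ fun z hz => Submodule.smul_mem _ _ ?_
    have hzy := hf2 z (Finsupp.mem_support_iff.1 hz)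
    have hl := hzy.length_lt
    exact ih _ (by omega) z (hS y hy z hzy) (by omega) rfl

/-- The Kazhdan–Lusztig basis elements exist. -/
theorem exists_isKL (x : minLeft cs I) : ∃ C, IsKL cs I ε x C := by
  obtain ⟨n, hn⟩ : ∃ n, cs.length (x : W) = n := ⟨_, rfl⟩
  induction n using Nat.strong_induction_on generalizing x with
  | _ n ih =>
    let K := klInd cs I ε
    have hK : ∀ y : minLeft cs I, cs.length (y : W) < n → IsKL cs I ε y (K y) := fun y hy =>
      Classical.epsilon_spec (ih _ hy y rfl)
    let S : Set (minLeft cs I) := {y | BruhatLT cs (y : W) (x : W)}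
    have hSn : ∀ y ∈ S, cs.length (y : W) < n := fun y hy => hn ▸ BruhatLT.length_lt cs hy
    -- The defect of bar-invariance of the standard element, expanded in the known basis elements.
    have hd : barInd M I ε (stdInd cs I ε x) - stdInd cs I ε x ∈ Submodule.span LZ (K '' S) := by
      refine Submodule.span_le.2 ?_ (barInd_stdInd_sub_mem cs I ε x)
      rintro _ ⟨y, hy, rfl⟩
      exact stdInd_mem_span_of_isKL cs hK (fun y hy z hz => hz.trans cs hy) y hy (hSn y hy)
    obtain ⟨g, hgS, hg⟩ := (Finsupp.mem_span_image_iff_linearCombination LZ).1 hd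
    have hgS' : ∀ y, g y ≠ 0 → y ∈ S := fun y hy =>
      (Finsupp.mem_supported LZ g).1 hgS (Finsupp.mem_support_iff.2 hy)
    have hbarK : ∀ f : minLeft cs I →₀ LZ, (∀ y, f y ≠ 0 → y ∈ S) →
        barInd M I ε (Finsupp.linearCombination LZ K f) =
          Finsupp.linearCombination LZ K (f.mapRange barLZ (map_zero _)) := by
      intro f hf
      rw [Finsupp.linearCombination_apply, Finsupp.linearCombination_apply,
        Finsupp.sum_mapRange_index (by simp), Finsupp.sum, map_sum]
      refine Finset.sum_congr rfl fun y hy => ?_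
      rw [LinearMap.map_smulₛₗ,
        (hK y (hSn y (hf y (Finsupp.mem_support_iff.1 hy)))).1]
    have hinv : ∀ m : IndModule M I ε, barInd M I ε (barInd M I ε m) = m := by
      intro m
      obtain ⟨h, rfl⟩ := indMk_surjective I ε m
      rw [barInd_indMk, barInd_indMk]
      congr 1
      have : (bar M).comp (bar M) = RingHom.id _ := by
        refine hecke_ringHom_ext M (fun r => ?_) fun s => ?_
        · rw [RingHom.comp_apply, bar_algebraMap, bar_algebraMap, RingHom.id_apply]
          congr 1
          exact LaurentPolynomial.involutive_invert r
        · rw [RingHom.comp_apply, bar_gen, map_add, bar_gen, bar_algebraMap, map_sub barLZ, barLZ_v,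
            barLZ_vInv, RingHom.id_apply, add_assoc, ← map_add]
          simp
      exact RingHom.congr_fun this h
    have hganti : ∀ y, barLZ (g y) = - g y := by
      have h1 : Finsupp.linearCombination LZ K (g.mapRange barLZ (map_zero _) + g) = 0 := by
        rw [map_add, ← hbarK g hgS', hg, map_sub, hinv]; abel
      have h2 := eq_zero_of_linearCombination_isKL cs (fun y hy => hK y (hSn y (hgS' y ?_))) h1
      · intro y
        have h3 := congrArg (fun u : minLeft cs I →₀ LZ => u y) h2
        simp only [Finsupp.add_apply, Finsupp.mapRange_apply, Finsupp.zero_apply] at h3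
        exact eq_neg_of_add_eq_zero_left h3
      · rintro h0
        simp [h0] at hy
    let h := g.mapRange posPart posPart_zero
    have hhS : ∀ y, h y ≠ 0 → y ∈ S := by
      intro y hy
      refine hgS' y fun h0 => hy ?_
      rw [Finsupp.mapRange_apply, h0, posPart_zero]
    have hgh : g = h - h.mapRange barLZ (map_zero _) := by
      ext1 y
      rw [Finsupp.sub_apply, Finsupp.mapRange_apply, Finsupp.mapRange_apply]
      exact eq_posPart_sub (hganti y)
    have hrepr : ∀ y, (stdBasis cs I ε).repr (Finsupp.linearCombination LZ K h) y =
        ∑ z ∈ h.support, h z * (stdBasis cs I ε).repr (K z) y := by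
      intro y
      rw [Finsupp.linearCombination_apply, Finsupp.sum, map_sum, Finsupp.finsetSum_apply]
      exact Finset.sum_congr rfl fun z _ => by rw [map_smul, Finsupp.smul_apply, smul_eq_mul]
    refine ⟨stdInd cs I ε x + Finsupp.linearCombination LZ K h, ?_,
      (stdBasis cs I ε).repr (Finsupp.linearCombination LZ K h), ?_, ?_, ?_⟩
    · rw [map_add, hbarK h hhS, eq_add_of_sub_eq hg.symm]
      conv_lhs => rw [hgh, map_sub]
      abel
    · intro y
      rw [hrepr]
      refine sum_mem_vZv fun z hz => mul_mem_vZv ?_ ?_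
      · rw [Finsupp.mapRange_apply]; exact posPart_mem_vZv _
      · exact (hK z (hSn z (hhS z (Finsupp.mem_support_iff.1 hz)))).repr_mem_Zv cs y
    · intro y hy
      rw [hrepr] at hy
      obtain ⟨z, hz, hzy⟩ := Finset.exists_ne_zero_of_sum_ne_zero hy
      have hzS := hhS z (Finsupp.mem_support_iff.1 hz)
      rcases (hK z (hSn z hzS)).eq_or_bruhatLT cs (right_ne_zero_of_mul hzy) with h | h
      · rw [h]; exact hzS
      · exact h.trans cs hzS
    · rw [← coe_stdBasis, Module.Basis.linearCombination_repr]

theorem isKL_klInd (x : minLeft cs I) : IsKL cs I ε x (klInd cs I ε x) :=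
  Classical.epsilon_spec (exists_isKL cs x)

variable (I ε) in
/-- The Kazhdan–Lusztig basis of the induced module. -/
def klBasis : Module.Basis (minLeft cs I) LZ (IndModule M I ε) :=
  Module.Basis.mk (v := klInd cs I ε)
    (linearIndependent_iff.2 fun _ hg =>
      eq_zero_of_linearCombination_isKL cs (fun y _ => isKL_klInd cs y) hg)
    (by
      rw [← span_stdInd cs I ε, Submodule.span_le]
      rintro _ ⟨y, rfl⟩
      rw [← Set.image_univ]
      exact stdInd_mem_span_of_isKL cs (n := cs.length (y : W) + 1) (fun y _ => isKL_klInd cs y)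
        (fun _ _ _ _ => trivial) y trivial (by omega))

theorem coe_klBasis : ⇑(klBasis cs I ε) = klInd cs I ε := Module.Basis.coe_mk _ _

theorem coords_coe_basis {ι N : Type*} [AddCommGroup N] [Module LZ N] (b : Module.Basis ι LZ N)
    (m : N) : coords (b : ι → N) m = b.repr m := by
  have h := Function.leftInverse_invFun (linearIndependent_iff_injective_finsuppLinearCombination.1
    b.linearIndependent) (b.repr m)
  rwa [b.linearCombination_repr] at h

theorem klPoly_eq (y x : minLeft cs I) :
    klPoly cs I ε y x = (stdBasis cs I ε).repr (klInd cs I ε x) y := by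
  rw [klPoly, ← coe_stdBasis, coords_coe_basis]

theorem invKLPoly_eq (y x : minLeft cs I) : invKLPoly cs I ε y x =
    (-1) ^ (cs.length (y : W) + cs.length (x : W)) *
      (klBasis cs I ε).repr (stdInd cs I ε y) x := by
  rw [invKLPoly, ← coe_klBasis, coords_coe_basis]

end KLBasis

/-! ### The symmetrizer of a finite parabolic subgroup -/

section Symmetrizer

variable {B : Type*} {M : CoxeterMatrix B} {W : Type*} [Group W] (cs : CoxeterSystem M W)
  {I : Set B} (hI : Finite (parabolic cs I))

theorem length_mul_simple_longest_lt {i : B} (hi : i ∈ I) :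
    cs.length (longest cs I hI * cs.simple i) < cs.length (longest cs I hI) :=
  lt_of_le_of_ne (length_le_longest cs hI
      (mul_mem (longest_mem cs hI) (simple_mem_parabolic cs hi)))
    (cs.length_mul_simple_ne _ _)

/-- The longest element of `W_I` is the maximum of `W_I` in the Bruhat order. -/
theorem eq_or_bruhatLT_longest {u : W} (hu : u ∈ parabolic cs I) :
    u = longest cs I hI ∨ BruhatLT cs u (longest cs I hI) := by
  have key : ∀ u ∈ parabolic cs I, longest cs I hI * u⁻¹ = longest cs I hI ∨
      BruhatLT cs (longest cs I hI * u⁻¹) (longest cs I hI) := by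
    intro u hu
    refine parabolic_induction cs (p := fun u => longest cs I hI * u⁻¹ = longest cs I hI ∨
      BruhatLT cs (longest cs I hI * u⁻¹) (longest cs I hI)) (by simp) ?_ hu
    intro i hi u _ _ ih
    have h1 := length_mul_simple_longest_lt cs hI hi
    have h2 : BruhatLT cs (longest cs I hI * cs.simple i) (longest cs I hI) := by
      have := bruhatLT_mul_simple cs (x := longest cs I hI * cs.simple i) (j := i)
      rw [cs.simple_mul_simple_cancel_right] at this
      exact this h1
    rw [mul_inv_rev, cs.inv_simple, ← mul_assoc]
    rcases ih with ih | ih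
    · rw [ih]; exact .inr h2
    · rcases bruhat_mul_simple cs ih i with h | h | h
      · exact .inl h
      · exact .inr (h.trans cs h2)
      · exact .inr h
  simpa using key (u⁻¹ * longest cs I hI) (mul_mem (inv_mem hu) (longest_mem cs hI))

theorem length_lt_longest {u : W} (hu : u ∈ parabolic cs I) (hne : u ≠ longest cs I hI) :
    cs.length u < cs.length (longest cs I hI) :=
  ((eq_or_bruhatLT_longest cs hI hu).resolve_left hne).length_lt

/-- The elements of a finite parabolic subgroup. -/
def parFinset : Finset W :=
  haveI := hI
  (Set.toFinite (parabolic cs I : Set W)).toFinset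

theorem mem_parFinset {w : W} : w ∈ parFinset cs hI ↔ w ∈ parabolic cs I :=
  Set.Finite.mem_toFinset _

/-- The coefficient `v ^ (ℓ(w_I) - ℓ(w))`. -/
def symCoeff (w : W) : LZ :=
  LaurentPolynomial.T ((cs.length (longest cs I hI) : ℤ) - cs.length w)

/-- The element `∑ v ^ (ℓ(w_I) - ℓ(w)) H_w` of the Hecke algebra, with `w` running through the
finite parabolic subgroup `W_I`. -/
def symElt : HeckeAlgebra M := ∑ w ∈ parFinset cs hI, symCoeff cs hI w • stdHecke cs w

theorem gen_mul_stdHecke_eq (i : B) (w : W) : gen M i * stdHecke cs w =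
    stdHecke cs (cs.simple i * w) + leftCoeff cs i w • stdHecke cs w := by
  rcases cs.length_simple_mul w i with h | h
  · rw [gen_mul_stdHecke cs h, leftCoeff, if_neg (by omega), zero_smul, add_zero]
  · rw [gen_mul_stdHecke' cs h, leftCoeff, if_pos (by omega)]

/-- The Hecke algebra of `W_I` acts on the symmetrizer through the trivial module. -/
theorem gen_mul_symElt {i : B} (hi : i ∈ I) :
    gen M i * symElt cs hI = vInv • symElt cs hI := by
  have hs := simple_mem_parabolic cs hi
  have e1 : ∑ w ∈ parFinset cs hI, symCoeff cs hI w • stdHecke cs (cs.simple i * w) =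
      ∑ w ∈ parFinset cs hI, symCoeff cs hI (cs.simple i * w) • stdHecke cs w := by
    refine Finset.sum_nbij' (cs.simple i * ·) (cs.simple i * ·) ?_ ?_ ?_ ?_ ?_
    · intro w hw
      exact (mem_parFinset cs hI).2 (mul_mem hs ((mem_parFinset cs hI).1 hw))
    · intro w hw
      exact (mem_parFinset cs hI).2 (mul_mem hs ((mem_parFinset cs hI).1 hw))
    · intro w _; exact cs.simple_mul_simple_cancel_left i
    · intro w _; exact cs.simple_mul_simple_cancel_left i
    · intro w _; rw [cs.simple_mul_simple_cancel_left]
  have e0 : gen M i * symElt cs hI =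
      ∑ w ∈ parFinset cs hI, gen M i * (symCoeff cs hI w • stdHecke cs w) :=
    Finset.mul_sum ..
  have e2 : vInv • symElt cs hI =
      ∑ w ∈ parFinset cs hI, vInv • (symCoeff cs hI w • stdHecke cs w) :=
    Finset.smul_sum
  rw [e0, e2]
  simp only [mul_smul_comm, gen_mul_stdHecke_eq, smul_add, Finset.sum_add_distrib]
  rw [e1, ← Finset.sum_add_distrib]
  refine Finset.sum_congr rfl fun w _ => ?_
  rw [smul_smul, smul_smul, ← add_smul]
  congr 1
  simp only [symCoeff, leftCoeff]
  rcases cs.length_simple_mul w i with h | h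
  · rw [if_neg (by omega), mul_zero, add_zero, ← LaurentPolynomial.T_add, h]
    congr 1; push_cast; ring
  · rw [if_pos (by omega), mul_sub, ← LaurentPolynomial.T_add, ← LaurentPolynomial.T_add,
      ← LaurentPolynomial.T_add, ← h]
    push_cast
    ring_nf

theorem heckeCoords_apply_eq_zero {S : Set W} {h : HeckeAlgebra M}
    (hh : h ∈ Submodule.span LZ (stdHecke cs '' S)) {w : W} (hw : w ∉ S) :
    heckeCoords cs h w = 0 := by
  classical
  induction hh using Submodule.span_induction with
  | mem x hx =>
    obtain ⟨y, hy, rfl⟩ := hx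
    rw [heckeCoords_stdHecke, Finsupp.single_apply, if_neg]
    rintro rfl; exact hw hy
  | zero => simp
  | add x y _ _ hx hy => rw [map_add, Finsupp.add_apply, hx, hy, add_zero]
  | smul r x _ hx => rw [map_smul, Finsupp.smul_apply, hx, smul_zero]

theorem bar_stdHecke_mem_span {w : W} (hw : w ∈ parabolic cs I) : bar M (stdHecke cs w) ∈
    Submodule.span LZ (stdHecke cs '' (parabolic cs I : Set W)) := by
  refine parabolic_induction cs (p := fun w => bar M (stdHecke cs w) ∈
    Submodule.span LZ (stdHecke cs '' (parabolic cs I : Set W))) ?_ ?_ hw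
  · rw [stdHecke_one, map_one]
    exact Submodule.subset_span ⟨1, one_mem _, stdHecke_one cs⟩
  · intro i hi u hu hl ih
    rw [← gen_mul_stdHecke cs hl, map_mul, bar_gen, add_mul, ← Algebra.smul_def]
    refine add_mem ?_ (Submodule.smul_mem _ _ ih)
    generalize bar M (stdHecke cs u) = x at ih
    induction ih using Submodule.span_induction with
    | mem x hx =>
      obtain ⟨y, hy, rfl⟩ := hx
      rw [gen_mul_stdHecke_eq]
      exact add_mem
        (Submodule.subset_span ⟨_, mul_mem (simple_mem_parabolic cs hi) hy, rfl⟩)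
        (Submodule.smul_mem _ _ (Submodule.subset_span ⟨y, hy, rfl⟩))
    | zero => rw [mul_zero]; exact zero_mem _
    | add x y _ _ hx hy => rw [mul_add]; exact add_mem hx hy
    | smul r x _ hx => rw [mul_smul_comm]; exact Submodule.smul_mem _ _ hx

/-- An element in the span of the `H_w`, `w ∈ W_I`, on which each `H_s` with `s ∈ I` acts from the
left by `v⁻¹` is determined by its coefficient at the longest element. -/
theorem eq_zero_of_gen_mul_eq {h : HeckeAlgebra M}
    (hspan : h ∈ Submodule.span LZ (stdHecke cs '' (parabolic cs I : Set W)))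
    (hgen : ∀ i ∈ I, gen M i * h = vInv • h)
    (hlong : heckeCoords cs h (longest cs I hI) = 0) : h = 0 := by
  have hstep : ∀ i ∈ I, ∀ u, heckeCoords cs h u = 0 → heckeCoords cs h (cs.simple i * u) = 0 := by
    intro i hi u hu
    have e := congrArg (heckeCoords cs) (hgen i hi)
    rw [heckeCoords_gen_mul, map_smul] at e
    have e' := congrArg (fun f : W →₀ LZ => f u) e
    simpa [leftOp_apply, hu] using e'
  apply heckeCoords_injective cs
  rw [map_zero]
  ext1 w
  by_cases hw : w ∈ parabolic cs I
  · have key : ∀ u ∈ parabolic cs I, heckeCoords cs h (u * longest cs I hI) = 0 := by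
      intro u hu
      refine parabolic_induction cs (p := fun u => heckeCoords cs h (u * longest cs I hI) = 0)
        (by rwa [one_mul]) ?_ hu
      intro i hi u _ _ ih
      rw [mul_assoc]; exact hstep i hi _ ih
    have := key (w * (longest cs I hI)⁻¹) (mul_mem hw (inv_mem (longest_mem cs hI)))
    rwa [inv_mul_cancel_right] at this
  · exact heckeCoords_apply_eq_zero cs hspan hw

/-- The symmetrizer is bar-invariant: its conjugate is again an eigenvector with eigenvalue `v⁻¹` of
each `H_s` with `s ∈ I`, and has the same coefficient at the longest element. -/
theorem bar_symElt : bar M (symElt cs hI) = symElt cs hI := by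
  classical
  have hsmul : ∀ (r : LZ) (x : HeckeAlgebra M), bar M (r • x) = barLZ r • bar M x :=
    fun r x => LinearMap.map_smulₛₗ (barₛₗ M) r x
  refine sub_eq_zero.1 (eq_zero_of_gen_mul_eq cs hI ?_ ?_ ?_)
  · rw [symElt, map_sum]
    refine Submodule.sub_mem _ (Submodule.sum_mem _ fun w hw => ?_)
      (Submodule.sum_mem _ fun w hw => ?_)
    · rw [hsmul]
      exact Submodule.smul_mem _ _ (bar_stdHecke_mem_span cs ((mem_parFinset cs hI).1 hw))
    · exact Submodule.smul_mem _ _ (Submodule.subset_span ⟨w, (mem_parFinset cs hI).1 hw, rfl⟩)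
  · intro i hi
    have h1 := congrArg (bar M) (gen_mul_symElt cs hI hi)
    rw [map_mul, bar_gen, hsmul, barLZ_vInv, add_mul, ← Algebra.smul_def] at h1
    have h2 : (v - vInv) • bar M (symElt cs hI) =
        v • bar M (symElt cs hI) - vInv • bar M (symElt cs hI) := by
      rw [Algebra.smul_def, Algebra.smul_def, Algebra.smul_def, map_sub]
      exact sub_mul _ _ _
    have h3 : gen M i * bar M (symElt cs hI) = vInv • bar M (symElt cs hI) := by
      rw [← eq_sub_iff_add_eq, h2] at h1
      rw [h1, sub_sub_cancel]
    calc gen M i * (bar M (symElt cs hI) - symElt cs hI)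
        = gen M i * bar M (symElt cs hI) - gen M i * symElt cs hI := mul_sub _ _ _
      _ = vInv • bar M (symElt cs hI) - vInv • symElt cs hI := by
        rw [h3, gen_mul_symElt cs hI hi]
      _ = vInv • (bar M (symElt cs hI) - symElt cs hI) := (smul_sub _ _ _).symm
  · have h1 : ∀ w ∈ parFinset cs hI, heckeCoords cs (bar M (stdHecke cs w)) (longest cs I hI) =
        heckeCoords cs (stdHecke cs w) (longest cs I hI) := by
      intro w hw
      rw [← sub_eq_zero, ← Finsupp.sub_apply, ← map_sub]
      refine heckeCoords_apply_eq_zero cs (bar_stdHecke_sub_mem cs w) fun hlt => ?_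
      have h2 := BruhatLT.length_lt cs hlt
      have h3 := length_le_longest cs hI ((mem_parFinset cs hI).1 hw)
      omega
    rw [map_sub, Finsupp.sub_apply, sub_eq_zero, symElt, map_sum, map_sum, map_sum,
      Finsupp.finsetSum_apply, Finsupp.finsetSum_apply]
    refine Finset.sum_congr rfl fun w hw => ?_
    rw [hsmul, map_smul, map_smul, Finsupp.smul_apply, Finsupp.smul_apply, h1 w hw,
      heckeCoords_stdHecke, Finsupp.single_apply]
    split_ifs with hwl
    · rw [hwl, symCoeff, sub_self, LaurentPolynomial.T_zero, map_one]
    · rw [smul_zero, smul_zero]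

end Symmetrizer

/-! ### The anti-involution of the Hecke algebra -/

section AntiInvolution

open MulOpposite

theorem altProd_op {A : Type*} [Monoid A] (n : ℕ) : ∀ a b : A, altProd (op a) (op b) n =
    op (if Even n then altProd b a n else altProd a b n) := by
  induction n with
  | zero => intro a b; simp [altProd]
  | succ n ih =>
    intro a b
    rw [altProd, ih b a, altProd_succ_right, altProd_succ_right]
    by_cases h : Even n <;> simp [h, Nat.even_add_one]

variable {B : Type*} (M : CoxeterMatrix B)

/-- The anti-involution of the Hecke algebra with `H_s ↦ H_s`, as a homomorphism to the opposite
algebra. -/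
def antiHom : HeckeAlgebra M →+* (HeckeAlgebra M)ᵐᵒᵖ :=
  heckeLift M (algebraMap LZ _) (fun r a => Algebra.commutes r a) (fun s => op (gen M s))
    (by
      intro s
      have h := gen_quadratic M s
      have h1 : Commute (gen M s) (algebraMap LZ (HeckeAlgebra M) vInv) :=
        (Algebra.commutes _ _).symm
      have h2 : Commute (algebraMap LZ (HeckeAlgebra M) v)
          (gen M s - algebraMap LZ (HeckeAlgebra M) vInv) := Algebra.commutes _ _
      have hc : Commute (gen M s + algebraMap LZ (HeckeAlgebra M) v)
          (gen M s - algebraMap LZ (HeckeAlgebra M) vInv) :=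
        ((Commute.refl (gen M s)).sub_right h1).add_left h2
      rw [hc.eq] at h
      rw [MulOpposite.algebraMap_apply, MulOpposite.algebraMap_apply, ← op_add, ← op_sub, ← op_mul,
        h, op_zero])
    (by
      intro s t
      rw [altProd_op, altProd_op, gen_braid])

/-- The anti-involution of the Hecke algebra with `H_s ↦ H_s`. -/
def anti : HeckeAlgebra M →ₗ[LZ] HeckeAlgebra M where
  toFun x := unop (antiHom M x)
  map_add' x y := by rw [map_add, unop_add]
  map_smul' r x := by
    rw [Algebra.smul_def, map_mul, unop_mul, antiHom, heckeLift_algebraMap,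
      MulOpposite.algebraMap_apply, unop_op, ← Algebra.commutes, ← Algebra.smul_def,
      RingHom.id_apply]

theorem anti_mul (x y : HeckeAlgebra M) : anti M (x * y) = anti M y * anti M x :=
  (congrArg unop (map_mul (antiHom M) x y)).trans (unop_mul _ _)

theorem anti_one : anti M 1 = 1 := (congrArg unop (map_one (antiHom M))).trans unop_one

theorem anti_gen (i : B) : anti M (gen M i) = gen M i :=
  congrArg unop (heckeLift_gen M _ _ _ _ _ i)

theorem anti_bar (x : HeckeAlgebra M) : anti M (bar M x) = bar M (anti M x) := by
  have key : (antiHom M).comp (bar M) = ((bar M).op).comp (antiHom M) := by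
    have e : ∀ r, antiHom M (algebraMap LZ _ r) = op (algebraMap LZ _ r) := fun r =>
      heckeLift_algebraMap ..
    have g : ∀ i, antiHom M (gen M i) = op (gen M i) := fun i => heckeLift_gen ..
    refine hecke_ringHom_ext M (fun r => ?_) fun s => ?_
    · rw [RingHom.comp_apply, RingHom.comp_apply, bar_algebraMap, e, e]
      exact congrArg op (bar_algebraMap M r).symm
    · rw [RingHom.comp_apply, RingHom.comp_apply, bar_gen, map_add, e, g, ← op_add]
      exact congrArg op (bar_gen M s).symm
  exact congrArg unop (RingHom.congr_fun key x)

variable {M} {W : Type*} [Group W] (cs : CoxeterSystem M W)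

theorem anti_stdHecke (w : W) : anti M (stdHecke cs w) = stdHecke cs w⁻¹ := by
  obtain ⟨ω, hω, rfl⟩ := cs.exists_isReduced w
  rw [← cs.wordProd_reverse, stdHecke_wordProd cs hω, stdHecke_wordProd cs hω.reverse]
  clear hω
  induction ω with
  | nil => simpa using anti_one M
  | cons i ω ih => simp [anti_mul, ih, anti_gen]

end AntiInvolution

/-! ### The comparison map between the spherical and the anti-spherical module -/

section Comparison

variable {B : Type*} {M : CoxeterMatrix B} {W : Type*} [Group W] (cs : CoxeterSystem M W)
  {I : Set B} (J : Set B) (hI : Finite (parabolic cs I))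

/-- Right multiplication by `c` on the Hecke algebra. -/
def mulRight (c : HeckeAlgebra M) : HeckeAlgebra M →ₗ[LZ] HeckeAlgebra M where
  toFun x := x * c
  map_add' x y := add_mul x y c
  map_smul' r x := smul_mul_assoc r x c

/-- The comparison map from the spherical module of `I` to the anti-spherical module of `J`: it
sends `1 ⊗ h` to `1 ⊗ h' C`, where `h'` is the image of `h` under the anti-involution fixing
the `H_s`, and `C` is the element `symElt` attached to `I`. -/
def compMap : IndModule M I .triv →ₗ[LZ] IndModule M J .sign :=
  indLift (indMk M J .sign ∘ₗ mulRight (symElt cs hI) ∘ₗ anti M) fun i hi x => by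
    change indMk M J .sign (anti M (gen M i * x) * symElt cs hI) =
      vInv • indMk M J .sign (anti M x * symElt cs hI)
    rw [anti_mul, anti_gen, mul_assoc, gen_mul_symElt cs hI hi, mul_smul_comm, map_smul]

theorem compMap_indMk (x : HeckeAlgebra M) : compMap cs J hI (indMk M I .triv x) =
    indMk M J .sign (anti M x * symElt cs hI) :=
  indLift_indMk _ _ x

theorem compMap_barInd (m : IndModule M I .triv) :
    compMap cs J hI (barInd M I .triv m) = barInd M J .sign (compMap cs J hI m) := by
  obtain ⟨x, rfl⟩ := indMk_surjective I .triv m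
  rw [barInd_indMk, compMap_indMk, compMap_indMk, barInd_indMk, map_mul (bar M), bar_symElt,
    anti_bar]

theorem compMap_stdInd (x : minLeft cs I) : compMap cs J hI (stdInd cs I .triv x) =
    indMk M J .sign (stdHecke cs (x : W)⁻¹ * symElt cs hI) := by
  rw [stdInd_eq, compMap_indMk, anti_stdHecke]

theorem compMap_stdInd_eq_sum (x : minLeft cs I) : compMap cs J hI (stdInd cs I .triv x) =
    ∑ w ∈ parFinset cs hI, symCoeff cs hI w • indMk M J .sign (stdHecke cs ((x : W)⁻¹ * w)) := by
  have e : stdHecke cs (x : W)⁻¹ * symElt cs hI =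
      ∑ w ∈ parFinset cs hI, stdHecke cs (x : W)⁻¹ * (symCoeff cs hI w • stdHecke cs w) :=
    Finset.mul_sum ..
  rw [compMap_stdInd, e, map_sum]
  refine Finset.sum_congr rfl fun w hw => ?_
  rw [mul_smul_comm, map_smul, stdHecke_mul cs
    (length_mul_of_mem_minRight cs (inv_mem_minRight cs x.2) ((mem_parFinset cs hI).1 hw))]

theorem symCoeff_mem_Zv {w : W} (hw : w ∈ parabolic cs I) : symCoeff cs hI w ∈ Zv :=
  T_mem_Zv (by have := length_le_longest cs hI hw; omega)

theorem symCoeff_mem_vZv {w : W} (hw : w ∈ parabolic cs I) (hne : w ≠ longest cs I hI) :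
    symCoeff cs hI w ∈ vZv :=
  T_mem_vZv (by have := length_lt_longest cs hI hw hne; omega)

theorem symCoeff_longest : symCoeff cs hI (longest cs I hI) = 1 := by
  rw [symCoeff, sub_self, LaurentPolynomial.T_zero]

theorem repr_compMap_stdInd_mem_Zv (x : minLeft cs I) (y : minLeft cs J) :
    (stdBasis cs J .sign).repr (compMap cs J hI (stdInd cs I .triv x)) y ∈ Zv := by
  classical
  rw [compMap_stdInd_eq_sum, map_sum, Finsupp.finsetSum_apply]
  refine sum_mem fun w hw => ?_
  rw [map_smul, Finsupp.smul_apply, smul_eq_mul, indMk_stdHecke, map_smul, repr_stdInd,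
    Finsupp.smul_apply, Finsupp.single_apply, smul_eq_mul]
  refine mul_mem (symCoeff_mem_Zv cs hI ((mem_parFinset cs hI).1 hw)) (mul_mem ?_ ?_)
  · exact pow_mem (neg_mem v_mem_Zv) _
  · split_ifs
    exacts [one_mem _, zero_mem _]

/-- The element of `ᴵW` given by the inverse of a regular double coset representative. -/
def regInv (z : regReps cs J I) : minLeft cs I := ⟨(z : W)⁻¹, inv_mem_minLeft cs z.2.2.1⟩

/-- The element `z w_I` of `ᴶW` attached to a regular double coset representative `z`. -/
def regLong (z : regReps cs J I) : minLeft cs J :=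
  ⟨(z : W) * longest cs I hI, mul_mem_minLeft_of_regReps cs z.2 (longest_mem cs hI)⟩

theorem regLong_injective : Function.Injective (regLong cs J hI) := by
  intro z z' h
  exact Subtype.ext (mul_right_cancel (congrArg Subtype.val h))

open Classical in
theorem repr_compMap_regInv (z : regReps cs J I) (y : minLeft cs J) :
    (stdBasis cs J .sign).repr (compMap cs J hI (stdInd cs I .triv (regInv cs J z))) y =
      ∑ w ∈ parFinset cs hI, symCoeff cs hI w * if (z : W) * w = y then 1 else 0 := by
  rw [compMap_stdInd_eq_sum, map_sum, Finsupp.finsetSum_apply]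
  refine Finset.sum_congr rfl fun w hw => ?_
  have hzw := mul_mem_minLeft_of_regReps cs z.2 ((mem_parFinset cs hI).1 hw)
  have e : ((regInv cs J z : W))⁻¹ * w = (⟨(z : W) * w, hzw⟩ : minLeft cs J) := by
    simp [regInv]
  rw [e, ← stdInd_eq, map_smul, repr_stdInd, Finsupp.smul_apply, Finsupp.single_apply, smul_eq_mul]
  congr 2
  rw [eq_iff_iff]
  exact Subtype.ext_iff

open Classical in
/-- The image of the standard basis element of `z⁻¹` is the standard basis element of `z w_I`, up to
coefficients in `v ℤ[v]`. -/
theorem repr_compMap_regInv_sub_mem_vZv (z : regReps cs J I) (y : minLeft cs J) :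
    (stdBasis cs J .sign).repr (compMap cs J hI (stdInd cs I .triv (regInv cs J z))) y -
      (if regLong cs J hI z = y then 1 else 0) ∈ vZv := by
  rw [repr_compMap_regInv, ← Finset.add_sum_erase _ _
    ((mem_parFinset cs hI).2 (longest_mem cs hI)), symCoeff_longest, one_mul]
  have e : (if (z : W) * longest cs I hI = y then (1 : LZ) else 0) =
      if regLong cs J hI z = y then 1 else 0 := by
    congr 1
    rw [eq_iff_iff]
    exact (Subtype.ext_iff (a1 := regLong cs J hI z)).symm
  rw [e, add_sub_cancel_left]
  refine sum_mem_vZv fun w hw => ?_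
  obtain ⟨hne, hw⟩ := Finset.mem_erase.1 hw
  refine mul_mem_vZv (symCoeff_mem_vZv cs hI ((mem_parFinset cs hI).1 hw) hne) ?_
  split_ifs
  exacts [one_mem _, zero_mem _]

open Classical in
/-- The images of the standard basis elements of the `z⁻¹` are told apart by their coefficients at
the elements `z w_I`. -/
theorem repr_compMap_regInv_regLong (z z' : regReps cs J I) :
    (stdBasis cs J .sign).repr (compMap cs J hI (stdInd cs I .triv (regInv cs J z)))
      (regLong cs J hI z') = if z = z' then 1 else 0 := by
  have hl := longest_mem cs hI
  have key : ∀ w ∈ parFinset cs hI, (z : W) * w = regLong cs J hI z' →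
      z = z' ∧ w = longest cs I hI := by
    intro w hw h
    replace h : (z : W) * w = z' * longest cs I hI := h
    have h1 := minLeft_eq_of_mul_eq cs (regInv cs J z).2 (regInv cs J z').2
      (inv_mem ((mem_parFinset cs hI).1 hw)) (inv_mem hl) (by
        change w⁻¹ * (z : W)⁻¹ = (longest cs I hI)⁻¹ * (z' : W)⁻¹
        rw [← mul_inv_rev, h, mul_inv_rev])
    have h2 : z = z' := Subtype.ext (inv_injective h1)
    subst h2
    exact ⟨rfl, mul_left_cancel h⟩
  rw [repr_compMap_regInv]
  by_cases hz : z = z'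
  · subst hz
    rw [if_pos rfl, Finset.sum_eq_single_of_mem _ ((mem_parFinset cs hI).2 hl)]
    · rw [symCoeff_longest, one_mul]; exact if_pos rfl
    · intro w hw hne
      rw [if_neg fun h => hne (key w hw h).2, mul_zero]
  · rw [if_neg hz]
    exact Finset.sum_eq_zero fun w hw => by rw [if_neg fun h => hz (key w hw h).1, mul_zero]

/-- Outside the regular double coset representatives, the comparison map either kills a standard
basis element or sends it to `-v` times the image of a shorter one. -/
theorem compMap_stdInd_of_not_regReps (x : minLeft cs I) (hx : (x : W)⁻¹ ∉ regReps cs J I) :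
    compMap cs J hI (stdInd cs I .triv x) = 0 ∨
      ∃ x' : minLeft cs I, cs.length (x' : W) < cs.length (x : W) ∧
        compMap cs J hI (stdInd cs I .triv x) = (-v) • compMap cs J hI (stdInd cs I .triv x') := by
  obtain ⟨j, hj, h | ⟨h, i, hi, e⟩⟩ := exists_simple_of_not_regReps cs x.2 hx
  · refine .inr ⟨⟨_, mul_simple_mem_minLeft_of_lt cs x.2 h⟩, h, ?_⟩
    rw [compMap_stdInd, compMap_stdInd]
    have h1 := gen_mul_stdHecke cs (i := j) (w := ((x : W) * cs.simple j)⁻¹) (by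
      rw [mul_inv_rev, cs.inv_simple, cs.simple_mul_simple_cancel_left, cs.length_inv]
      have h2 := cs.length_mul_simple (x : W) j
      rw [← cs.length_inv (x * cs.simple j), mul_inv_rev, cs.inv_simple] at h2 h
      omega)
    rw [mul_inv_rev, cs.inv_simple, cs.simple_mul_simple_cancel_left] at h1
    rw [mul_inv_rev, cs.inv_simple, ← h1, mul_assoc, indMk_gen_mul hj]
    rfl
  · left
    -- Here `H_s` with `s ∈ J` moves past `H_{x⁻¹}` to `H_t` with `t ∈ I`, so that `-v` and `v⁻¹`
    -- act in the same way.
    have h0 := cs.length_mul_simple (x : W) j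
    have e' : cs.simple j * (x : W)⁻¹ = (x : W)⁻¹ * cs.simple i := by
      have := congrArg (fun g => g⁻¹) e
      simpa using this.symm
    have hl : cs.length (cs.simple j * (x : W)⁻¹) = cs.length (x : W)⁻¹ + 1 := by
      rw [← cs.length_inv (x * cs.simple j), mul_inv_rev, cs.inv_simple] at h h0
      rw [cs.length_inv (x : W)]
      omega
    have h1 := gen_mul_stdHecke cs hl
    have h2 := stdHecke_mul_gen cs (i := i) (w := (x : W)⁻¹) (by rw [← e', hl])
    rw [e', ← h2] at h1
    have h3 := indMk_gen_mul (ε := .sign) hj (stdHecke cs (x : W)⁻¹ * symElt cs hI)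
    rw [← mul_assoc, h1, mul_assoc, gen_mul_symElt cs hI hi, mul_smul_comm, map_smul,
      ← compMap_stdInd] at h3
    have h4 : (v + vInv) • compMap cs J hI (stdInd cs I .triv x) = 0 := by
      rw [add_smul, h3, ← add_smul, OneDim.scalar, add_neg_cancel, zero_smul]
    apply (stdBasis cs J .sign).repr.injective
    ext1 y
    have h5 := congrArg (fun m => (stdBasis cs J .sign).repr m y) h4
    simp only [map_smul, Finsupp.smul_apply, map_zero, Finsupp.zero_apply, smul_eq_mul] at h5
    rw [map_zero, Finsupp.zero_apply]
    exact (mul_eq_zero.1 h5).resolve_left v_add_vInv_ne_zero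

theorem repr_compMap_mem_vZv_of_not_regReps (x : minLeft cs I) (hx : (x : W)⁻¹ ∉ regReps cs J I)
    (y : minLeft cs J) :
    (stdBasis cs J .sign).repr (compMap cs J hI (stdInd cs I .triv x)) y ∈ vZv := by
  rcases compMap_stdInd_of_not_regReps cs J hI x hx with h | ⟨x', -, h⟩
  · rw [h, map_zero]; exact zero_mem_vZv
  · rw [h, map_smul, Finsupp.smul_apply, smul_eq_mul, neg_mul, ← mul_neg]
    exact v_mul_mem_vZv (neg_mem (repr_compMap_stdInd_mem_Zv cs J hI x' y))

/-- The image of the comparison map is spanned by the images of the standard basis elements attached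
to the regular double coset representatives. -/
theorem compMap_mem_span (m : IndModule M I .triv) : compMap cs J hI m ∈ Submodule.span LZ
    (Set.range fun z => compMap cs J hI (stdInd cs I .triv (regInv cs J z))) := by
  have key : ∀ n, ∀ x : minLeft cs I, cs.length (x : W) = n →
      compMap cs J hI (stdInd cs I .triv x) ∈ Submodule.span LZ
        (Set.range fun z => compMap cs J hI (stdInd cs I .triv (regInv cs J z))) := by
    intro n
    induction n using Nat.strong_induction_on with
    | _ n ih =>
      intro x hn
      by_cases hx : (x : W)⁻¹ ∈ regReps cs J I
      · refine Submodule.subset_span ⟨⟨_, hx⟩, ?_⟩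
        have : regInv cs J ⟨_, hx⟩ = x := Subtype.ext (inv_inv _)
        simp only [this]
      · rcases compMap_stdInd_of_not_regReps cs J hI x hx with h | ⟨x', hl, h⟩
        · rw [h]; exact zero_mem _
        · rw [h]; exact Submodule.smul_mem _ _ (ih _ (by omega) x' rfl)
  have hm : m ∈ Submodule.span LZ (Set.range (stdInd cs I .triv)) := by
    rw [span_stdInd]; trivial
  induction hm using Submodule.span_induction with
  | mem m hm => obtain ⟨x, rfl⟩ := hm; exact key _ x rfl
  | zero => rw [map_zero]; exact zero_mem _
  | add a b _ _ ha hb => rw [map_add]; exact add_mem ha hb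
  | smul r a _ ha => rw [map_smul]; exact Submodule.smul_mem _ _ ha

theorem repr_compMap_klInd_sub_mem_vZv (x : minLeft cs I) (y : minLeft cs J) :
    (stdBasis cs J .sign).repr (compMap cs J hI (klInd cs I .triv x)) y -
      (stdBasis cs J .sign).repr (compMap cs J hI (stdInd cs I .triv x)) y ∈ vZv := by
  obtain ⟨-, f, hf, -, e⟩ := isKL_klInd cs (I := I) (ε := .triv) x
  rw [e, map_add, map_add, Finsupp.add_apply, add_sub_cancel_left,
    Finsupp.linearCombination_apply, Finsupp.sum, map_sum, map_sum, Finsupp.finsetSum_apply]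
  refine sum_mem_vZv fun z _ => ?_
  rw [map_smul, map_smul, Finsupp.smul_apply, smul_eq_mul]
  exact mul_mem_vZv (hf z) (repr_compMap_stdInd_mem_Zv cs J hI z y)

/-- The comparison map sends the Kazhdan–Lusztig basis element of `z⁻¹` to that of `z w_I`. -/
theorem compMap_klInd_regInv (z : regReps cs J I) :
    compMap cs J hI (klInd cs I .triv (regInv cs J z)) = klInd cs J .sign (regLong cs J hI z) := by
  classical
  have h1 := isKL_klInd cs (I := I) (ε := .triv) (regInv cs J z)
  have h2 := isKL_klInd cs (I := J) (ε := .sign) (regLong cs J hI z)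
  refine sub_eq_zero.1 (eq_zero_of_barInd_eq cs ?_ fun y => ?_)
  · rw [map_sub, ← compMap_barInd, h1.1, h2.1]
  · obtain ⟨f, hf, -, e⟩ := h2.exists_repr
    have h3 := add_mem_vZv (repr_compMap_klInd_sub_mem_vZv cs J hI (regInv cs J z) y)
      (repr_compMap_regInv_sub_mem_vZv cs J hI z y)
    have h4 := sub_mem_vZv h3 (hf y)
    rw [map_sub, Finsupp.sub_apply, e]
    convert h4 using 1
    ring

/-- The comparison map kills the Kazhdan–Lusztig basis elements whose index is not the inverse of a
regular double coset representative. -/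
theorem compMap_klInd_of_not_regReps (x : minLeft cs I) (hx : (x : W)⁻¹ ∉ regReps cs J I) :
    compMap cs J hI (klInd cs I .triv x) = 0 := by
  refine eq_zero_of_barInd_eq cs ?_ fun y => ?_
  · rw [← compMap_barInd, (isKL_klInd cs x).1]
  · have h := add_mem_vZv (repr_compMap_klInd_sub_mem_vZv cs J hI x y)
      (repr_compMap_mem_vZv_of_not_regReps cs J hI x hx y)
    rwa [sub_add_cancel] at h

/-- The coordinate of `compMap m` at `z w_I` in the Kazhdan–Lusztig basis is the coordinate of `m`
at `z⁻¹`. -/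
theorem klBasis_repr_compMap (m : IndModule M I .triv) (z : regReps cs J I) :
    (klBasis cs J .sign).repr (compMap cs J hI m) (regLong cs J hI z) =
      (klBasis cs I .triv).repr m (regInv cs J z) := by
  classical
  have key : (klBasis cs J .sign).coord (regLong cs J hI z) ∘ₗ compMap cs J hI =
      (klBasis cs I .triv).coord (regInv cs J z) := by
    refine (klBasis cs I .triv).ext fun x => ?_
    rw [LinearMap.comp_apply, Module.Basis.coord_apply, Module.Basis.coord_apply,
      Module.Basis.repr_self, coe_klBasis, Finsupp.single_apply]
    by_cases hx : (x : W)⁻¹ ∈ regReps cs J I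
    · obtain ⟨z', rfl⟩ : ∃ z', x = regInv cs J z' := ⟨⟨_, hx⟩, Subtype.ext (inv_inv _).symm⟩
      rw [compMap_klInd_regInv, ← coe_klBasis, Module.Basis.repr_self, Finsupp.single_apply]
      have h1 : (regLong cs J hI z' = regLong cs J hI z) ↔ z' = z :=
        (regLong_injective cs J hI).eq_iff
      have h2 : (regInv cs J z' = regInv cs J z) ↔ z' = z :=
        ⟨fun h => Subtype.ext (inv_injective (congrArg Subtype.val h)), fun h => h ▸ rfl⟩
      simp only [h1, h2]
    · rw [compMap_klInd_of_not_regReps cs J hI x hx, map_zero, Finsupp.zero_apply, if_neg]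
      rintro rfl
      apply hx
      change ((z : W)⁻¹)⁻¹ ∈ _
      rw [inv_inv]; exact z.2
  exact LinearMap.congr_fun key m

/-- The inversion formula, in terms of the coordinates in the two Kazhdan–Lusztig bases. -/
theorem exists_finsupp_inversion [DecidableEq W] (x y : regReps cs J I) :
    ∃ h : regReps cs J I →₀ LZ,
      (∀ z, h z = klPoly cs J .sign (regLong cs J hI z) (regLong cs J hI x)) ∧
      ∑ z ∈ h.support, h z *
        (klBasis cs I .triv).repr (stdInd cs I .triv (regInv cs J z)) (regInv cs J y) =
        if x = y then 1 else 0 := by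
  have hmem := compMap_mem_span cs J hI (klInd cs I .triv (regInv cs J x))
  rw [compMap_klInd_regInv] at hmem
  obtain ⟨h, hh⟩ := (Finsupp.mem_span_range_iff_exists_finsupp).1 hmem
  refine ⟨h, fun z => ?_, ?_⟩
  · classical
    rw [klPoly_eq, ← hh, Finsupp.sum, map_sum, Finsupp.finsetSum_apply]
    simp only [map_smul, Finsupp.smul_apply, repr_compMap_regInv_regLong, smul_eq_mul, mul_ite,
      mul_one, mul_zero]
    rw [Finset.sum_ite_eq']
    split_ifs with hz
    · rfl
    · exact Finsupp.notMem_support_iff.1 hz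
  · have e := congrArg (fun m => (klBasis cs J .sign).repr m (regLong cs J hI y)) hh
    simp only [Finsupp.sum, map_sum, map_smul, Finsupp.finsetSum_apply, Finsupp.smul_apply,
      klBasis_repr_compMap, smul_eq_mul] at e
    rw [e, ← coe_klBasis, Module.Basis.repr_self, Finsupp.single_apply]
    simp only [(regLong_injective cs J hI).eq_iff]

end Comparison

end ParabolicKL

end

theorem theoremA1 {B : Type*} {M : CoxeterMatrix B} {W : Type*} [Group W] [DecidableEq W]
    (cs : CoxeterSystem M W) (I J : Set B) (hI : Finite (ParabolicKL.parabolic cs I)) :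
    ∃ hJ : ∀ z : ParabolicKL.regReps cs J I,
        (z : W) * ParabolicKL.longest cs I hI ∈ ParabolicKL.minLeft cs J,
      ∀ x y : ParabolicKL.regReps cs J I,
        let F : ParabolicKL.regReps cs J I → ParabolicKL.LZ := fun z =>
          (-1) ^ (cs.length (y : W) + cs.length (z : W)) *
            ParabolicKL.antisphericalKL cs J
              ⟨(z : W) * ParabolicKL.longest cs I hI, hJ z⟩
              ⟨(x : W) * ParabolicKL.longest cs I hI, hJ x⟩ *
            ParabolicKL.inverseSphericalKL cs I
              ⟨(z : W)⁻¹, ParabolicKL.inv_mem_minLeft cs z.2.2.1⟩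
              ⟨(y : W)⁻¹, ParabolicKL.inv_mem_minLeft cs y.2.2.1⟩
        F.support.Finite ∧ ∑ᶠ z, F z = if x = y then 1 else 0 := by
  refine ⟨fun z => ParabolicKL.mul_mem_minLeft_of_regReps cs z.2 (ParabolicKL.longest_mem cs hI),
    fun x y => ?_⟩
  intro F
  obtain ⟨h, hh, hsum⟩ := ParabolicKL.exists_finsupp_inversion cs J hI x y
  -- The sign in the definition of the inverse polynomials cancels the sign in the sum.
  have hF : ∀ z, F z = h z * (ParabolicKL.klBasis cs I .triv).repr
      (ParabolicKL.stdInd cs I .triv (ParabolicKL.regInv cs J z)) (ParabolicKL.regInv cs J y) := by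
    intro z
    have e1 := ParabolicKL.invKLPoly_eq cs (ε := .triv) (ParabolicKL.regInv cs J z)
      (ParabolicKL.regInv cs J y)
    have e2 : cs.length (ParabolicKL.regInv cs J z : W) + cs.length (ParabolicKL.regInv cs J y : W)
        = cs.length (y : W) + cs.length (z : W) := by
      rw [add_comm]
      exact congrArg₂ _ (cs.length_inv _) (cs.length_inv _)
    rw [e2] at e1
    change _ * ParabolicKL.klPoly cs J .sign (ParabolicKL.regLong cs J hI z)
      (ParabolicKL.regLong cs J hI x) * ParabolicKL.invKLPoly cs I .triv
      (ParabolicKL.regInv cs J z) (ParabolicKL.regInv cs J y) = _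
    rw [e1, ← hh]
    have hs : ((-1 : ParabolicKL.LZ) ^ (cs.length (y : W) + cs.length (z : W))) *
        (-1) ^ (cs.length (y : W) + cs.length (z : W)) = 1 := by
      rw [← mul_pow]; simp
    linear_combination (h z * (ParabolicKL.klBasis cs I .triv).repr
      (ParabolicKL.stdInd cs I .triv (ParabolicKL.regInv cs J z))
      (ParabolicKL.regInv cs J y)) * hs
  have hsub : Function.support F ⊆ h.support := by
    intro z hz
    rw [Function.mem_support, hF] at hz
    exact Finsupp.mem_support_iff.2 (left_ne_zero_of_mul hz)
  refine ⟨h.support.finite_toSet.subset hsub, ?_⟩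
  rw [finsum_eq_sum_of_support_subset F hsub, ← hsum]
  exact Finset.sum_congr rfl fun z _ => hF z
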